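/- Conventions. Graphs are simple and may be infinite. Two rays (one-way infinite paths) of a graph $G$ are edge-equivalent if no finite set of edges separates them, i.e. if for every finite set $F$ of edges they have tails in the same component of $G-F$; the equivalence classes are the edge-ends of $G$, and $\Omega_E(G)$ is the set of edge-ends. A region of $G$ is a connected subgraph $C$ with only finitely many edges $xy\in E(G)$ such that $x\in C$ and $y\notin C$; $\Omega_E(C)$ is the set of edge-ends of $G$ all of whose rays have a tail in $C$, and $\|C\| = V(C)\cup\Omega_E(C)$. The sets $\|C\|$, for all regions $C$ of $G$, generate the topology of $\|G\| = V(G)\sqcup\Omega_E(G)$, and the sets $\Omega_E(C)$ generate that of the edge-end space $\Omega_E(G)$ (which is the subspace topology). Theorem 1.2. Up to homeomorphism, the edge-end spaces of connected graphs are precisely the subspaces $X\subseteq\|T\|$ with $\Omega_E(T)\subseteq X$, for a graph-theoretic tree $T$. That is, a topological space $Z$ is homeomorphic to $\Omega_E(G)$ for some connected graph $G$ if and only if there are a tree $T$ and a set $X$ with $\Omega_E(T)\subseteq X\subseteq\|T\|$ such that $Z$ is homeomorphic to $X$ with the subspace topology of $\|T\|$. -/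

import Mathlib

universe u v

namespace SimpleGraph

/-- A ray of `G`: a one-way infinite path `R 0, R 1, R 2, …`, with pairwise distinct vertices. -/
structure EdgeRay {V : Type u} (G : SimpleGraph V) where
  vert : ℕ → V
  injective : Function.Injective vert
  adj : ∀ n, G.Adj (vert n) (vert (n + 1))

/-- Two rays are edge-equivalent if no finite set `F` of edges separates them: for each such `F`
they have tails in a common component of `G - F`. -/
def EdgeEquiv {V : Type u} (G : SimpleGraph V) (R S : EdgeRay G) : Prop :=
  ∀ F : Set (Sym2 V), F.Finite →
    ∃ n, ∀ i, n ≤ i → ∀ j, n ≤ j → (G.deleteEdges F).Reachable (R.vert i) (S.vert j)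

/-- After the deletion of finitely many edges, a tail of a ray stays in one component. -/
theorem EdgeEquiv.refl {V : Type u} (G : SimpleGraph V) (R : EdgeRay G) : EdgeEquiv G R R := by
  intro F hF
  have hinj : Function.Injective (fun i : ℕ => s(R.vert i, R.vert (i + 1))) := by
    intro i j h
    have h' : s(R.vert i, R.vert (i + 1)) = s(R.vert j, R.vert (j + 1)) := h
    rw [Sym2.eq_iff] at h'
    rcases h' with ⟨h1, _⟩ | ⟨h1, h2⟩
    · exact R.injective h1
    · have := R.injective h1
      have := R.injective h2
      omega
  have hfin : ((fun i : ℕ => s(R.vert i, R.vert (i + 1))) ⁻¹' F).Finite :=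
    hF.preimage hinj.injOn
  obtain ⟨b, hb⟩ := hfin.bddAbove
  have step : ∀ k, (G.deleteEdges F).Reachable (R.vert (b + 1)) (R.vert (b + 1 + k)) := by
    intro k
    induction k with
    | zero => exact Reachable.refl _
    | succ k ih =>
      refine ih.trans (Adj.reachable ?_)
      rw [deleteEdges_adj]
      refine ⟨R.adj _, fun hmem => ?_⟩
      have : b + 1 + k ≤ b := hb hmem
      omega
  refine ⟨b + 1, fun i hi j hj => ?_⟩
  obtain ⟨k, rfl⟩ := Nat.exists_eq_add_of_le hi
  obtain ⟨l, rfl⟩ := Nat.exists_eq_add_of_le hj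
  exact (step k).symm.trans (step l)

/-- Edge-equivalence of rays, as an equivalence relation. -/
def edgeRaySetoid {V : Type u} (G : SimpleGraph V) : Setoid (EdgeRay G) where
  r := EdgeEquiv G
  iseqv :=
    { refl := EdgeEquiv.refl G
      symm := by
        intro R S h F hF
        obtain ⟨n, hn⟩ := h F hF
        exact ⟨n, fun i hi j hj => (hn j hj i hi).symm⟩
      trans := by
        intro R S Q h h' F hF
        obtain ⟨n, hn⟩ := h F hF
        obtain ⟨m, hm⟩ := h' F hF
        refine ⟨max n m, fun i hi j hj => ?_⟩
        exact (hn i (le_trans (le_max_left _ _) hi) (max n m) (le_max_left _ _)).trans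
          (hm (max n m) (le_max_right _ _) j (le_trans (le_max_right _ _) hj)) }

/-- The set `Ω_E(G)` of edge-ends of `G`: the edge-equivalence classes of rays. -/
def EdgeEnd {V : Type u} (G : SimpleGraph V) : Type u :=
  Quotient (edgeRaySetoid G)

/-- The edge-end that contains the ray `R`. -/
def EdgeRay.toEnd {V : Type u} {G : SimpleGraph V} (R : EdgeRay G) : EdgeEnd G :=
  Quotient.mk (edgeRaySetoid G) R

/-- The boundary of a vertex set `C`: the edges `xy` of `G` with `x ∈ C` and `y ∉ C`. -/
def cutEdges {V : Type u} (G : SimpleGraph V) (C : Set V) : Set (Sym2 V) :=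
  {e | ∃ x y, x ∈ C ∧ y ∉ C ∧ G.Adj x y ∧ e = s(x, y)}

/-- `C` is the vertex set of a region of `G`, that is, of a connected subgraph with finite
boundary. (A vertex set spans some connected subgraph iff it induces a connected one, and the
boundary depends only on the vertex set.) -/
def IsRegion {V : Type u} (G : SimpleGraph V) (C : Set V) : Prop :=
  (G.induce C).Connected ∧ (cutEdges G C).Finite

/-- The edge-end `ω` lives in `C`: every ray of `ω` has a tail in `C`. -/
def EdgeEnd.LivesIn {V : Type u} {G : SimpleGraph V} (ω : EdgeEnd G) (C : Set V) : Prop :=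
  ∀ R : EdgeRay G, R.toEnd = ω → ∃ n, ∀ i, n ≤ i → R.vert i ∈ C

/-- The edge-end space: the topology on `Ω_E(G)` generated by the sets `Ω_E(C)` of the
edge-ends that live in `C`, for all regions `C` of `G`. -/
instance EdgeEnd.instTopologicalSpace {V : Type u} (G : SimpleGraph V) :
    TopologicalSpace (EdgeEnd G) :=
  TopologicalSpace.generateFrom {U | ∃ C : Set V, IsRegion G C ∧ U = {ω | ω.LivesIn C}}

/-- The set `‖G‖ = V(G) ∪ Ω_E(G)`, a disjoint union. -/
inductive VertexEnd {V : Type u} (G : SimpleGraph V) : Type u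
  | vertex (v : V) : VertexEnd G
  | edgeEnd (ω : EdgeEnd G) : VertexEnd G

/-- The set `‖C‖ = C ∪ Ω_E(C)`. -/
def VertexEnd.hull {V : Type u} (G : SimpleGraph V) (C : Set V) : Set (VertexEnd G) :=
  {x | (∃ v ∈ C, x = VertexEnd.vertex v) ∨ (∃ ω : EdgeEnd G, ω.LivesIn C ∧ x = VertexEnd.edgeEnd ω)}

/-- The topology on `‖G‖` generated by the sets `‖C‖`, for all regions `C` of `G`. -/
instance VertexEnd.instTopologicalSpace {V : Type u} (G : SimpleGraph V) :
    TopologicalSpace (VertexEnd G) :=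
  TopologicalSpace.generateFrom {U | ∃ C : Set V, IsRegion G C ∧ U = VertexEnd.hull G C}

end SimpleGraph

/-! Both topologies are generated by all vertex sets of finite boundary, since the components of
such a set are regions. So only these sets matter: if a map `π` from `V(G)` to a tree `T` makes the
finite-boundary sets of `G` exactly the preimages of those of `T`, then `Ω_E(G)` embeds in `‖T‖`
(`exists_isEmbedding`). The image of an end exists by compactness: every ultrafilter on `V(T)`
converges in `‖T‖` (`IsTree.exists_forall_mem_iff`).

From `T` to `G`: enlarge every vertex in `X` to an infinite clique. No finite cut splits a clique,
so the projection is such a `π`. Rays inside a clique realise its vertex; a vertex outside `X` is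
not realised, because a ray visits it at most once.

From `G` to `T`: the nodes of `T` are connected sets of finite boundary, the root being `V(G)`.
Remove from a node `N` its core, a class of vertices that no finite cut separates; partition the
rest into connected sets of finite boundary, the children of `N` (`exists_partition`). The core is
chosen to contain a vertex of `N` nearest to a fixed root, which forces every vertex into some core
after finitely many steps (`iInter_eq_empty_of_rootDist`); `π` sends it to that node. Every child
has an edge leaving `N` minus its core, so only finitely many children meet a finite-boundary set
that misses the core (`finite_meet`); hence finite cuts of `G` induce finite cuts of `T`. Finally a
ray of `T` eventually descends through nodes with empty intersection, and `exists_ray_of_antitone`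
finds a ray of `G` with tails in all of them, so the image contains every end of `T`. -/

namespace SimpleGraph

/-! ### Connected vertex sets and components. -/

variable {V : Type u} {G : SimpleGraph V}

/-- The graph on the same vertex set with only the edges of `G` inside `K`. -/
def within (G : SimpleGraph V) (K : Set V) : SimpleGraph V where
  Adj a b := G.Adj a b ∧ a ∈ K ∧ b ∈ K
  symm := ⟨fun _ _ h => ⟨h.1.symm, h.2.2, h.2.1⟩⟩
  loopless := ⟨fun _ h => h.1.ne rfl⟩

theorem within_mono {K L : Set V} (h : K ⊆ L) : G.within K ≤ G.within L :=
  fun _ _ hab => ⟨hab.1, h hab.2.1, h hab.2.2⟩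

theorem Reachable.exists_adj_boundary {x y : V} (h : G.Reachable x y) {D : Set V}
    (hx : x ∈ D) (hy : y ∉ D) : ∃ a b, a ∈ D ∧ b ∉ D ∧ G.Adj a b := by
  obtain ⟨p⟩ := h
  obtain ⟨d, -, h1, h2⟩ := p.exists_boundary_dart D hx hy
  exact ⟨d.fst, d.snd, h1, h2, d.adj⟩

/-- Any two vertices of `K` are joined by a path inside `K`. -/
def IsConn (G : SimpleGraph V) (K : Set V) : Prop :=
  ∀ x ∈ K, ∀ y ∈ K, (G.within K).Reachable x y

theorem IsConn.exists_boundary {K D : Set V} (h : IsConn G K) {x y : V} (hx : x ∈ K)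
    (hy : y ∈ K) (hxD : x ∈ D) (hyD : y ∉ D) :
    ∃ a b, a ∈ K ∧ b ∈ K ∧ a ∈ D ∧ b ∉ D ∧ G.Adj a b := by
  obtain ⟨a, b, ha, hb, hab⟩ := (h x hx y hy).exists_adj_boundary hxD hyD
  exact ⟨a, b, hab.2.1, hab.2.2, ha, hb, hab.1⟩

/-- Apply the hypothesis to the set of vertices reached from `x` inside `K`. -/
theorem isConn_of_boundary {K : Set V} {x : V}
    (hx : x ∈ K)
    (h : ∀ D : Set V, x ∈ D → D ⊆ K → D ≠ K → ∃ a b, a ∈ D ∧ b ∈ K ∧ b ∉ D ∧ G.Adj a b) : IsConn G K := by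
  have key : ∀ y ∈ K, (G.within K).Reachable x y := by
    by_contra! hc
    obtain ⟨y, hy, hxy⟩ := hc
    obtain ⟨a, b, ha, hb, hbD, hab⟩ := h {z | z ∈ K ∧ (G.within K).Reachable x z}
      ⟨hx, Reachable.refl _⟩ (fun z hz => hz.1) (fun h => hxy (h.symm.subset hy).2)
    exact hbD ⟨hb, ha.2.trans (Adj.reachable ⟨hab, ha.1, hb⟩)⟩
  exact fun a ha b hb => (key a ha).symm.trans (key b hb)

/-- The component of `x` in the subgraph induced on `K`. -/
def comp (G : SimpleGraph V) (K : Set V) (x : V) : Set V := {y | (G.within K).Reachable x y}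

theorem self_mem_comp (K : Set V) (x : V) : x ∈ comp G K x := Reachable.refl _

theorem comp_eq_of_mem {K : Set V} {x y : V} (h : y ∈ comp G K x) : comp G K y = comp G K x := by
  ext z
  exact ⟨fun hz => Reachable.trans h hz, fun hz => (Reachable.symm h).trans hz⟩

theorem mem_comp_of_adj {K : Set V} {x a b : V} (ha : a ∈ comp G K x) (haK : a ∈ K) (hb : b ∈ K)
    (hab : G.Adj a b) : b ∈ comp G K x :=
  Reachable.trans ha (Adj.reachable ⟨hab, haK, hb⟩)

theorem comp_subset {K : Set V} {x : V} (hx : x ∈ K) : comp G K x ⊆ K := by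
  intro y hy
  by_contra hyK
  obtain ⟨a, b, -, hb, hab⟩ := Reachable.exists_adj_boundary hy hx hyK
  exact hb hab.2.2

theorem isConn_comp {K : Set V} {x : V} (_ : x ∈ K) : IsConn G (comp G K x) := by
  refine isConn_of_boundary (self_mem_comp K x) fun D hxD hD hne => ?_
  obtain ⟨y, hy, hyD⟩ := Set.exists_of_ssubset (hD.ssubset_of_ne hne)
  obtain ⟨a, b, ha, hb, hab⟩ := Reachable.exists_adj_boundary hy hxD hyD
  exact ⟨a, b, ha, mem_comp_of_adj (hD ha) hab.2.1 hab.2.2 hab.1, hb, hab.1⟩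

theorem IsConn.connected_induce {K : Set V} (h : IsConn G K) (hne : K.Nonempty) :
    (G.induce K).Connected := by
  obtain ⟨x, hx⟩ := hne
  have : Nonempty K := ⟨⟨x, hx⟩⟩
  refine Connected.mk (fun a b => ?_)
  by_contra hab
  obtain ⟨c, d, hc, hd, hcK, hdK, hcd⟩ := h.exists_boundary (D := {z | ∃ hz : z ∈ K,
    (G.induce K).Reachable a ⟨z, hz⟩}) a.2 b.2 ⟨a.2, Reachable.refl _⟩ (fun ⟨_, h⟩ => hab h)
  exact hdK ⟨hd, hcK.2.trans (Adj.reachable (by simpa using hcd))⟩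

theorem IsConn.subset_comp {K L : Set V} (h : IsConn G K) (hKL : K ⊆ L) {x : V} (hx : x ∈ K) :
    K ⊆ comp G L x := fun y hy => (h x hx y hy).mono (within_mono hKL)

/-! ### Vertex sets with finite boundary -/

/-- The boundary of `D` is finite. -/
def FinCut (G : SimpleGraph V) (D : Set V) : Prop := (cutEdges G D).Finite

theorem mem_cutEdges {D : Set V} {x y : V} :
    s(x, y) ∈ cutEdges G D ↔ G.Adj x y ∧ ((x ∈ D ∧ y ∉ D) ∨ (x ∉ D ∧ y ∈ D)) := by
  constructor
  · rintro ⟨a, b, ha, hb, hab, he⟩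
    rcases Sym2.eq_iff.1 he with ⟨rfl, rfl⟩ | ⟨rfl, rfl⟩
    · exact ⟨hab, Or.inl ⟨ha, hb⟩⟩
    · exact ⟨hab.symm, Or.inr ⟨hb, ha⟩⟩
  · rintro ⟨hab, ⟨h1, h2⟩ | ⟨h1, h2⟩⟩
    · exact ⟨x, y, h1, h2, hab, rfl⟩
    · exact ⟨y, x, h2, h1, hab.symm, Sym2.eq_swap⟩

theorem FinCut.of_subset {D : Set V} {F : Set (Sym2 V)} (hF : F.Finite)
    (h : ∀ x y, x ∈ D → y ∉ D → G.Adj x y → s(x, y) ∈ F) : FinCut G D := by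
  refine hF.subset ?_
  rintro e ⟨x, y, hx, hy, hxy, rfl⟩
  exact h x y hx hy hxy

theorem FinCut.compl {D : Set V} (h : FinCut G D) : FinCut G Dᶜ :=
  FinCut.of_subset h fun _ _ hx hy hxy => mem_cutEdges.2
    ⟨hxy, Or.inr ⟨hx, not_not.1 hy⟩⟩

theorem FinCut.inter {C D : Set V} (hC : FinCut G C) (hD : FinCut G D) : FinCut G (C ∩ D) :=
  FinCut.of_subset (hC.union hD) fun x y hx hy hxy => by
    by_cases hyC : y ∈ C
    · exact Or.inr (mem_cutEdges.2 ⟨hxy, Or.inl ⟨hx.2, fun h => hy ⟨hyC, h⟩⟩⟩)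
    · exact Or.inl (mem_cutEdges.2 ⟨hxy, Or.inl ⟨hx.1, hyC⟩⟩)

theorem finCut_univ : FinCut G Set.univ :=
  FinCut.of_subset Set.finite_empty fun _ y _ hy _ => (hy (Set.mem_univ y)).elim

theorem FinCut.union {C D : Set V} (hC : FinCut G C) (hD : FinCut G D) : FinCut G (C ∪ D) := by
  have := (hC.compl.inter hD.compl).compl
  rwa [← Set.compl_union, compl_compl] at this

theorem finCut_empty : FinCut G ∅ :=
  FinCut.of_subset Set.finite_empty fun _ _ h _ _ => h.elim

theorem FinCut.biUnion {ι : Type*} {s : Set ι} (hs : s.Finite) {f : ι → Set V}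
    (h : ∀ i ∈ s, FinCut G (f i)) : FinCut G (⋃ i ∈ s, f i) := by
  induction s, hs using Set.Finite.induction_on with
  | empty => simpa using finCut_empty
  | insert _ _ ih =>
    rw [Set.biUnion_insert]
    exact (h _ (Set.mem_insert _ _)).union (ih fun i hi => h i (Set.mem_insert_of_mem _ hi))

theorem FinCut.comp {D : Set V} (h : FinCut G D) {x : V} (hx : x ∈ D) : FinCut G (comp G D x) :=
  FinCut.of_subset h fun _ _ ha hb hab => mem_cutEdges.2
    ⟨hab, Or.inl ⟨comp_subset hx ha, fun hbD => hb (mem_comp_of_adj ha (comp_subset hx ha) hbD hab)⟩⟩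

/-- The vertices incident with a boundary edge of `D`. -/
def cutVerts (G : SimpleGraph V) (D : Set V) : Set V := {x | ∃ y, s(x, y) ∈ cutEdges G D}

theorem FinCut.finite_cutVerts {D : Set V} (h : FinCut G D) : (cutVerts G D).Finite := by
  have h2 : (⋃ e ∈ cutEdges G D, {v | v ∈ e}).Finite := by
    refine Set.Finite.biUnion h fun e _ => ?_
    induction e using Sym2.ind with
    | _ a b =>
      refine (Set.toFinite {a, b}).subset fun v hv => ?_
      simpa using hv
  refine h2.subset fun x ⟨y, hy⟩ => ?_
  simp only [Set.mem_iUnion]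
  exact ⟨_, hy, by simp⟩

theorem mem_cutVerts_left {D : Set V} {x y : V} (h : G.Adj x y) (hx : x ∈ D) (hy : y ∉ D) :
    x ∈ cutVerts G D := ⟨y, mem_cutEdges.2 ⟨h, Or.inl ⟨hx, hy⟩⟩⟩

theorem IsConn.exists_mem_cutVerts {K D : Set V} (h : IsConn G K) {x y : V} (hx : x ∈ K)
    (hy : y ∈ K) (hxD : x ∈ D) (hyD : y ∉ D) : ∃ a ∈ K, a ∈ cutVerts G D := by
  obtain ⟨a, b, ha, -, haD, hb, hab⟩ := h.exists_boundary hx hy hxD hyD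
  exact ⟨a, ha, mem_cutVerts_left hab haD hb⟩

/-! ### Edge-ends and finite boundaries -/

open Filter

theorem reachable_deleteEdges_cutEdges {D : Set V} {x y : V}
    (h : (G.deleteEdges (cutEdges G D)).Reachable x y) : x ∈ D ↔ y ∈ D := by
  have key : ∀ {a b : V}, (G.deleteEdges (cutEdges G D)).Reachable a b → a ∈ D → b ∈ D := by
    intro a b hab ha
    by_contra hb
    obtain ⟨c, d, hc, hd, hcd⟩ := hab.exists_adj_boundary ha hb
    rw [deleteEdges_adj] at hcd
    exact hcd.2 (mem_cutEdges.2 ⟨hcd.1, Or.inl ⟨hc, hd⟩⟩)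
  exact ⟨key h, key h.symm⟩

theorem EdgeEquiv.eventually_mem_iff {R S : EdgeRay G} (h : EdgeEquiv G R S) {D : Set V}
    (hD : FinCut G D) :
    (∀ᶠ n in atTop, R.vert n ∈ D) ↔ (∀ᶠ n in atTop, S.vert n ∈ D) := by
  obtain ⟨n, hn⟩ := h _ hD
  have key := fun i hi j hj => reachable_deleteEdges_cutEdges (hn i hi j hj)
  simp only [eventually_atTop]
  constructor
  · rintro ⟨m, hm⟩
    exact ⟨n, fun j hj => (key (max n m) (le_max_left _ _) j hj).1 (hm _ (le_max_right _ _))⟩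
  · rintro ⟨m, hm⟩
    exact ⟨n, fun j hj => (key j hj (max n m) (le_max_left _ _)).2 (hm _ (le_max_right _ _))⟩

theorem EdgeRay.eventually_mem_or (R : EdgeRay G) {D : Set V} (hD : FinCut G D) :
    (∀ᶠ n in atTop, R.vert n ∈ D) ∨ (∀ᶠ n in atTop, R.vert n ∈ Dᶜ) := by
  obtain ⟨n, hn⟩ := EdgeEquiv.refl G R _ hD
  have key := fun i hi => reachable_deleteEdges_cutEdges (hn n le_rfl i hi)
  simp only [eventually_atTop]
  by_cases h : R.vert n ∈ D
  · exact Or.inl ⟨n, fun i hi => (key i hi).1 h⟩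
  · exact Or.inr ⟨n, fun i hi hc => h ((key i hi).2 hc)⟩

theorem EdgeRay.livesIn_iff (R : EdgeRay G) {D : Set V} (hD : FinCut G D) :
    R.toEnd.LivesIn D ↔ ∀ᶠ n in atTop, R.vert n ∈ D := by
  constructor
  · intro h
    exact eventually_atTop.2 (h R rfl)
  · intro h S hS
    have hSR : EdgeEquiv G S R := Quotient.exact hS
    exact eventually_atTop.1 ((hSR.eventually_mem_iff hD).2 h)

theorem EdgeRay.eventually_compl_iff (R : EdgeRay G) {D : Set V} (hD : FinCut G D) :
    (∀ᶠ n in atTop, R.vert n ∈ Dᶜ) ↔ ¬ ∀ᶠ n in atTop, R.vert n ∈ D := by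
  constructor
  · intro h h'
    obtain ⟨n, h1, h2⟩ := (h.and h').exists
    exact h1 h2
  · exact (R.eventually_mem_or hD).resolve_left

theorem EdgeEnd.exists_ray (ω : EdgeEnd G) : ∃ R : EdgeRay G, R.toEnd = ω :=
  Quotient.exists_rep ω

theorem EdgeEnd.livesIn_compl_iff (ω : EdgeEnd G) {D : Set V} (hD : FinCut G D) :
    ω.LivesIn Dᶜ ↔ ¬ ω.LivesIn D := by
  obtain ⟨R, rfl⟩ := ω.exists_ray
  rw [R.livesIn_iff hD, R.livesIn_iff hD.compl, R.eventually_compl_iff hD]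

theorem EdgeEnd.livesIn_mono {ω : EdgeEnd G} {C D : Set V} (h : ω.LivesIn C) (hCD : C ⊆ D) :
    ω.LivesIn D := fun R hR => (h R hR).imp fun _ hn i hi => hCD (hn i hi)

/-- A ray whose tail lies in `D` has a tail in a component of `D`. -/
theorem EdgeRay.exists_comp (R : EdgeRay G) {D : Set V} (h : ∀ᶠ n in atTop, R.vert n ∈ D) :
    ∃ x ∈ D, ∀ᶠ n in atTop, R.vert n ∈ SimpleGraph.comp G D x := by
  obtain ⟨n, hn⟩ := eventually_atTop.1 h
  refine ⟨R.vert n, hn n le_rfl, eventually_atTop.2 ⟨n, fun i hi => ?_⟩⟩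
  induction i, hi using Nat.le_induction with
  | base => exact self_mem_comp _ _
  | succ i hi ih => exact mem_comp_of_adj ih (hn i hi) (hn _ (by omega)) (R.adj i)

theorem EdgeEnd.exists_region {ω : EdgeEnd G} {D : Set V} (hD : FinCut G D) (h : ω.LivesIn D) :
    ∃ C ⊆ D, IsRegion G C ∧ ω.LivesIn C := by
  obtain ⟨R, rfl⟩ := ω.exists_ray
  obtain ⟨x, hx, h'⟩ := R.exists_comp ((R.livesIn_iff hD).1 h)
  exact ⟨_, comp_subset hx, ⟨(isConn_comp hx).connected_induce ⟨x, self_mem_comp _ _⟩, hD.comp hx⟩,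
    (R.livesIn_iff (hD.comp hx)).2 h'⟩

/-- After deleting a finite edge set that separates the two ends, the component containing a tail of
a ray of `ω` serves as `D`. -/
theorem EdgeEnd.exists_finCut_of_ne {ω ω' : EdgeEnd G} (h : ω ≠ ω') :
    ∃ D, FinCut G D ∧ ω.LivesIn D ∧ ¬ ω'.LivesIn D := by
  obtain ⟨R, rfl⟩ := ω.exists_ray
  obtain ⟨S, rfl⟩ := ω'.exists_ray
  by_contra! hc
  refine h (Quotient.sound fun F hF => ?_)
  obtain ⟨n, hn⟩ := EdgeEquiv.refl G R F hF
  obtain ⟨m, hm⟩ := EdgeEquiv.refl G S F hF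
  set D : Set V := {y | (G.deleteEdges F).Reachable (R.vert n) y} with hDdef
  have hD : FinCut G D := FinCut.of_subset hF fun x y hx hy hxy => by
    by_contra hF
    exact hy (Reachable.trans hx (Adj.reachable (by rw [deleteEdges_adj]; exact ⟨hxy, hF⟩)))
  have h1 := hc D hD ((R.livesIn_iff hD).2 (eventually_atTop.2 ⟨n, fun i hi => hn n le_rfl i hi⟩))
  obtain ⟨k, hk⟩ := eventually_atTop.1 ((S.livesIn_iff hD).1 h1)
  refine ⟨max n k, fun i hi j hj => ?_⟩
  exact (hn n le_rfl i (le_trans (le_max_left _ _) hi)).symm.trans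
    (hk j (le_trans (le_max_right _ _) hj))

/-! ### Finite-boundary sets generate the topologies. -/

namespace VertexEnd

theorem vertex_mem_hull {D : Set V} {v : V} : VertexEnd.vertex v ∈ hull G D ↔ v ∈ D := by
  simp [hull]

theorem edgeEnd_mem_hull {D : Set V} {ω : EdgeEnd G} :
    VertexEnd.edgeEnd ω ∈ hull G D ↔ ω.LivesIn D := by
  simp [hull]

theorem mem_hull_compl_iff {p : VertexEnd G} {D : Set V} (hD : FinCut G D) :
    p ∈ hull G Dᶜ ↔ p ∉ hull G D := by
  cases p with
  | vertex v => simp [vertex_mem_hull]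
  | edgeEnd ω => simp [edgeEnd_mem_hull, ω.livesIn_compl_iff hD]

theorem hull_mono {C D : Set V} (h : C ⊆ D) : hull G C ⊆ hull G D := by
  intro p hp
  cases p with
  | vertex v => exact vertex_mem_hull.2 (h (vertex_mem_hull.1 hp))
  | edgeEnd ω => exact edgeEnd_mem_hull.2 (EdgeEnd.livesIn_mono (edgeEnd_mem_hull.1 hp) h)

theorem exists_region {p : VertexEnd G} {D : Set V} (hD : FinCut G D) (h : p ∈ hull G D) :
    ∃ C ⊆ D, IsRegion G C ∧ p ∈ hull G C := by
  cases p with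
  | vertex v =>
    have hv := vertex_mem_hull.1 h
    exact ⟨_, comp_subset hv, ⟨(isConn_comp hv).connected_induce ⟨v, self_mem_comp _ _⟩,
      hD.comp hv⟩, vertex_mem_hull.2 (self_mem_comp _ _)⟩
  | edgeEnd ω =>
    obtain ⟨C, h1, h2, h3⟩ := EdgeEnd.exists_region hD (edgeEnd_mem_hull.1 h)
    exact ⟨C, h1, h2, edgeEnd_mem_hull.2 h3⟩

/-- A point of the hull of a finite-boundary set lies in the hull of one component, which is a
region. The gain over regions is closure under complements and intersections. -/
theorem topology_eq_generateFrom_finCut :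
    VertexEnd.instTopologicalSpace G
      = TopologicalSpace.generateFrom {U | ∃ D, FinCut G D ∧ U = hull G D} := by
  apply le_antisymm
  · refine le_generateFrom ?_
    rintro U ⟨D, hD, rfl⟩
    have : hull G D = ⋃₀ {U | ∃ C ⊆ D, IsRegion G C ∧ U = hull G C} := by
      ext p
      constructor
      · intro hp
        obtain ⟨C, h1, h2, h3⟩ := exists_region hD hp
        exact ⟨_, ⟨C, h1, h2, rfl⟩, h3⟩
      · rintro ⟨_, ⟨C, h1, h2, rfl⟩, h3⟩
        exact hull_mono h1 h3
    rw [this]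
    refine isOpen_sUnion ?_
    rintro _ ⟨C, -, hC, rfl⟩
    exact TopologicalSpace.GenerateOpen.basic _ ⟨C, hC, rfl⟩
  · refine TopologicalSpace.generateFrom_anti ?_
    rintro U ⟨C, hC, rfl⟩
    exact ⟨C, hC.2, rfl⟩

end VertexEnd

theorem EdgeEnd.topology_eq_generateFrom_finCut :
    EdgeEnd.instTopologicalSpace G
      = TopologicalSpace.generateFrom {U | ∃ D, FinCut G D ∧ U = {ω | ω.LivesIn D}} := by
  apply le_antisymm
  · refine le_generateFrom ?_
    rintro U ⟨D, hD, rfl⟩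
    have : {ω : EdgeEnd G | ω.LivesIn D}
        = ⋃₀ {U | ∃ C ⊆ D, IsRegion G C ∧ U = {ω | ω.LivesIn C}} := by
      ext ω
      constructor
      · intro hω
        obtain ⟨C, h1, h2, h3⟩ := EdgeEnd.exists_region hD hω
        exact ⟨_, ⟨C, h1, h2, rfl⟩, h3⟩
      · rintro ⟨_, ⟨C, h1, h2, rfl⟩, h3⟩
        exact EdgeEnd.livesIn_mono h3 h1
    rw [this]
    refine isOpen_sUnion ?_
    rintro _ ⟨C, -, hC, rfl⟩
    exact TopologicalSpace.GenerateOpen.basic _ ⟨C, hC, rfl⟩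
  · refine TopologicalSpace.generateFrom_anti ?_
    rintro U ⟨C, hC, rfl⟩
    exact ⟨C, hC.2, rfl⟩

end SimpleGraph

namespace SimpleGraph

variable {V : Type u} {G : SimpleGraph V}

/-! ### Distance to the root of a component -/

/-- The distance of a vertex to a fixed vertex of its component. -/
noncomputable def rootDist (H : SimpleGraph V) (x : V) : ℕ :=
  H.dist (H.connectedComponentMk x).out x

theorem root_reachable (H : SimpleGraph V) (x : V) :
    H.Reachable (H.connectedComponentMk x).out x :=
  ConnectedComponent.exact (Quot.out_eq _)

theorem root_eq_of_reachable {H : SimpleGraph V} {x y : V} (h : H.Reachable x y) :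
    (H.connectedComponentMk x).out = (H.connectedComponentMk y).out := by
  rw [ConnectedComponent.sound h]

theorem Reachable.exists_adj_dist_lt {H : SimpleGraph V} {r x : V} (hr : H.Reachable r x)
    (h : H.dist r x ≠ 0) : ∃ y, H.Adj x y ∧ H.dist r y < H.dist r x := by
  obtain ⟨p, hp⟩ := hr.symm.exists_walk_length_eq_dist
  rw [dist_comm] at hp
  cases p with
  | nil => exact (h (by simp)).elim
  | @cons _ y _ hadj q =>
    refine ⟨y, hadj, ?_⟩
    rw [← hp, Walk.length_cons, dist_comm]
    exact Nat.lt_succ_of_le (dist_le q)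

theorem exists_adj_rootDist_lt {H : SimpleGraph V} {x : V} (h : rootDist H x ≠ 0) :
    ∃ y, H.Adj x y ∧ rootDist H y < rootDist H x := by
  obtain ⟨y, hxy, hlt⟩ := (root_reachable H x).exists_adj_dist_lt h
  refine ⟨y, hxy, ?_⟩
  rwa [rootDist, ← root_eq_of_reachable hxy.reachable]

/-- A minimiser other than the root has a neighbour nearer to the root, hence outside `S`; so it is
an end of one of the finitely many boundary edges. -/
theorem finite_minimal_rootDist {H : SimpleGraph V} {S : Set V} (hS : FinCut H S)
    (hc : ∀ x ∈ S, ∀ y ∈ S, H.Reachable x y) :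
    {x | x ∈ S ∧ ∀ z ∈ S, rootDist H x ≤ rootDist H z}.Finite := by
  have h2 : {x | x ∈ S ∧ x = (H.connectedComponentMk x).out}.Finite := by
    refine Set.Subsingleton.finite fun x hx y hy => ?_
    rw [hx.2, hy.2, root_eq_of_reachable (hc x hx.1 y hy.1)]
  refine (hS.finite_cutVerts.union h2).subset fun x ⟨hx, hmin⟩ => ?_
  by_cases h0 : rootDist H x = 0
  · exact Or.inr ⟨hx, ((root_reachable H x).dist_eq_zero_iff.1 h0).symm⟩
  · obtain ⟨y, hxy, hlt⟩ := exists_adj_rootDist_lt h0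
    exact Or.inl (mem_cutVerts_left hxy hx fun hy => absurd (hmin y hy) (by omega))

/-- For `x` in the intersection, the distances of the `r n` are nondecreasing and bounded by that of
`x`, so constant from some `N` on. The distinct vertices `r n`, `n ≥ N`, are then infinitely many
minimisers on `S N`. -/
theorem iInter_eq_empty_of_rootDist {H : SimpleGraph V} {S : ℕ → Set V} (hS : Antitone S)
    {r : ℕ → V} (hr : ∀ n, r n ∈ S n) (hr' : ∀ n, r n ∉ S (n + 1))
    (hmin : ∀ n, ∀ z ∈ S n, rootDist H (r n) ≤ rootDist H z) (hcut : ∀ n, FinCut H (S n))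
    (hc : ∀ n, ∀ x ∈ S n, ∀ y ∈ S n, H.Reachable x y) : ⋂ n, S n = ∅ := by
  refine Set.eq_empty_of_forall_notMem fun x hx => ?_
  rw [Set.mem_iInter] at hx
  -- Minimising the difference maximises `rootDist H (r n)`; truncated subtraction is harmless
  -- because no `r n` is farther than `x`.
  obtain ⟨N, hN⟩ : ∃ N, ∀ n, rootDist H x - rootDist H (r N) ≤ rootDist H x - rootDist H (r n) := by
    have := WellFounded.has_min (measure fun n => rootDist H x - rootDist H (r n)).wf Set.univ
      ⟨0, trivial⟩
    obtain ⟨N, -, hN⟩ := this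
    exact ⟨N, fun n => not_lt.1 (hN n trivial)⟩
  have hinj : Function.Injective r := by
    have key : ∀ m n, m < n → r m ≠ r n := fun m n hmn h => hr' m (h ▸ hS hmn (hr n))
    intro m n h
    rcases lt_trichotomy m n with hmn | hmn | hmn
    · exact (key m n hmn h).elim
    · exact hmn
    · exact (key n m hmn h.symm).elim
  refine Set.infinite_of_injective_forall_mem (f := fun n => r (N + n))
    (hinj.comp (add_right_injective N)) (fun n => ?_) (finite_minimal_rootDist (hcut N) (hc N))
  have h1 := hmin N _ (hS (Nat.le_add_right N n) (hr (N + n)))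
  have h2 := hN (N + n)
  have h3 := hmin _ _ (hx (N + n))
  have h4 := hmin _ _ (hx N)
  refine ⟨hS (Nat.le_add_right N n) (hr _), fun z hz => ?_⟩
  have h5 := hmin N z hz
  omega

/-! ### Recursive splitting -/

/-- A rule that splits each good set `S` into a core and further good sets, its parts;
`part S x` is the part that contains `x`. -/
structure Splitting (V : Type u) where
  Good : Set V → Prop
  core : Set V → Set V
  part : Set V → V → Set V
  mem_part : ∀ {S x}, Good S → x ∈ S → x ∉ core S → x ∈ part S x
  part_subset : ∀ {S x}, Good S → x ∈ S → x ∉ core S → part S x ⊆ S \ core S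
  good_part : ∀ {S x}, Good S → x ∈ S → x ∉ core S → Good (part S x)
  part_eq : ∀ {S x y}, Good S → x ∈ S → x ∉ core S → y ∈ part S x → part S y = part S x

namespace Splitting

variable (σ : Splitting V) {S : Set V}

/-- The iterated parts that contain `x`, starting with `S`. -/
def chain (S : Set V) (x : V) : ℕ → Set V
  | 0 => S
  -- Once `x` lies in a core, `part` is unconstrained; the chain is meaningful only under `Alive`.
  | n + 1 => σ.part (chain S x n) x

/-- The sets that arise from `S` by iterated splitting. -/
inductive IsNode (S : Set V) : Set V → Prop
  | root : IsNode S S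
  | part {N : Set V} {x : V} : IsNode S N → x ∈ N → x ∉ σ.core N → IsNode S (σ.part N x)

/-- `x` is in none of the first `n` cores of its chain. -/
def Alive (S : Set V) (x : V) (n : ℕ) : Prop := ∀ m < n, x ∉ σ.core (σ.chain S x m)

variable {σ}

theorem mem_good_chain (hS : σ.Good S) {x : V} (hx : x ∈ S) {n : ℕ} (h : σ.Alive S x n) :
    x ∈ σ.chain S x n ∧ σ.Good (σ.chain S x n) := by
  induction n with
  | zero => exact ⟨hx, hS⟩
  | succ n ih =>
    obtain ⟨h1, h2⟩ := ih fun m hm => h m (by omega)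
    exact ⟨σ.mem_part h2 h1 (h n (by omega)), σ.good_part h2 h1 (h n (by omega))⟩

theorem isNode_chain (hS : σ.Good S) {x : V} (hx : x ∈ S) {n : ℕ} (h : σ.Alive S x n) :
    σ.IsNode S (σ.chain S x n) := by
  induction n with
  | zero => exact IsNode.root
  | succ n ih =>
    have h' : σ.Alive S x n := fun m hm => h m (by omega)
    exact IsNode.part (ih h') (mem_good_chain hS hx h').1 (h n (by omega))

theorem chain_succ_subset (hS : σ.Good S) {x : V} (hx : x ∈ S) {n : ℕ}
    (h : σ.Alive S x (n + 1)) :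
    σ.chain S x (n + 1) ⊆ σ.chain S x n \ σ.core (σ.chain S x n) := by
  obtain ⟨h1, h2⟩ := mem_good_chain hS hx (n := n) fun m hm => h m (by omega)
  exact σ.part_subset h2 h1 (h n (by omega))

theorem chain_subset_of_lt (hS : σ.Good S) {x : V} (hx : x ∈ S) {m n : ℕ} (hmn : m < n)
    (h : σ.Alive S x n) : σ.chain S x n ⊆ σ.chain S x m \ σ.core (σ.chain S x m) := by
  induction n, hmn using Nat.le_induction with
  | base => exact chain_succ_subset hS hx h
  | succ n hmn ih =>
    exact ((chain_succ_subset hS hx h).trans Set.sdiff_subset).trans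
      (ih fun k hk => h k (by omega))

theorem chain_subset_of_le (hS : σ.Good S) {x : V} (hx : x ∈ S) {m n : ℕ} (hmn : m ≤ n)
    (h : σ.Alive S x n) : σ.chain S x n ⊆ σ.chain S x m := by
  rcases hmn.eq_or_lt with rfl | hlt
  · exact subset_rfl
  · exact (chain_subset_of_lt hS hx hlt h).trans Set.sdiff_subset

theorem IsNode.good (hS : σ.Good S) {N : Set V} (h : σ.IsNode S N) : σ.Good N := by
  induction h with
  | root => exact hS
  | part _ hx hxc ih => exact σ.good_part ih hx hxc

theorem IsNode.subset (hS : σ.Good S) {N : Set V} (h : σ.IsNode S N) : N ⊆ S := by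
  induction h with
  | root => exact subset_rfl
  | part hN hx hxc ih => exact ((σ.part_subset (hN.good hS) hx hxc).trans Set.sdiff_subset).trans ih

/-- By `part_eq` a part may be named by any of its elements, so the nodes containing `x` are
linearly ordered by depth. -/
theorem IsNode.eq_chain (hS : σ.Good S) {N : Set V} (h : σ.IsNode S N) {x : V} (hx : x ∈ N) :
    ∃ n, σ.Alive S x n ∧ N = σ.chain S x n := by
  induction h with
  | root => exact ⟨0, fun m hm => by omega, rfl⟩
  | @part N y hN hy hyc ih =>
    have hx' := σ.part_subset (hN.good hS) hy hyc hx
    obtain ⟨n, hn, rfl⟩ := ih hx'.1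
    refine ⟨n + 1, fun m hm => ?_, (σ.part_eq (hN.good hS) hy hyc hx).symm⟩
    rcases Nat.lt_succ_iff_lt_or_eq.1 hm with h | rfl
    · exact hn m h
    · exact hx'.2

/-- If the minimisers of the root distance on good sets lie in the cores, then every vertex
ends up in a core. -/
theorem exists_mem_core (hS : σ.Good S) (H : SimpleGraph V)
    (hcut : ∀ N, σ.Good N → FinCut H N)
    (hc : ∀ N, σ.Good N → ∀ x ∈ N, ∀ y ∈ N, H.Reachable x y)
    (hr : ∀ N, σ.Good N → N.Nonempty → ∃ r ∈ N, r ∈ σ.core N ∧ ∀ z ∈ N, rootDist H r ≤ rootDist H z)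
    {x : V} (hx : x ∈ S) : ∃ n, x ∈ σ.core (σ.chain S x n) := by
  by_contra! h
  have halive : ∀ n, σ.Alive S x n := fun n m _ => h m
  have hgood := fun n => (mem_good_chain hS hx (halive n)).2
  have hmem := fun n => (mem_good_chain hS hx (halive n)).1
  choose r hr1 hr2 hr3 using fun n => hr _ (hgood n) ⟨x, hmem n⟩
  have := iInter_eq_empty_of_rootDist (H := H)
    (antitone_nat_of_succ_le fun n => chain_subset_of_le hS hx (Nat.le_succ n) (halive _)) hr1
    (fun n hn => (chain_succ_subset hS hx (halive (n + 1)) hn).2 (hr2 n)) hr3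
    (fun n => hcut _ (hgood n)) (fun n => hc _ (hgood n))
  exact Set.notMem_empty x (this ▸ Set.mem_iInter.2 hmem)

/-- The last node that contains `x`. -/
theorem exists_last_node (hS : σ.Good S) {x : V} (hx : x ∈ S)
    (h : ∃ n, x ∈ σ.core (σ.chain S x n)) :
    ∃ n, σ.Alive S x n ∧ x ∈ σ.core (σ.chain S x n) ∧ σ.IsNode S (σ.chain S x n) := by
  classical
  have h1 : σ.Alive S x (Nat.find h) := fun m hm => Nat.find_min h hm
  exact ⟨Nat.find h, h1, Nat.find_spec h, isNode_chain hS hx h1⟩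

/-- The node whose core contains `x` is unique. -/
theorem IsNode.eq_of_mem_core (hS : σ.Good S) {N M : Set V} (hN : σ.IsNode S N)
    (hM : σ.IsNode S M) {x : V} (hxN : x ∈ N) (hxM : x ∈ M) (hN' : x ∈ σ.core N)
    (hM' : x ∈ σ.core M) : N = M := by
  obtain ⟨n, hn, rfl⟩ := hN.eq_chain hS hxN
  obtain ⟨m, hm, rfl⟩ := hM.eq_chain hS hxM
  rcases lt_trichotomy n m with h | rfl | h
  · exact (hm n h hN').elim
  · rfl
  · exact (hn m h hM').elim

end Splitting

end SimpleGraph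

namespace SimpleGraph

variable {V : Type u} {G : SimpleGraph V}

/-! ### Partitions into connected sets of finite boundary -/

/-- A connected subset `K` of `Y` with an edge to the outside of `Y` and finitely many edges
to the rest of `Y`. -/
structure IsPiece (G : SimpleGraph V) (Y K : Set V) : Prop where
  subset : K ⊆ Y
  conn : IsConn G K
  finCut : FinCut (G.within Y) K
  exists_adj : ∃ a ∈ K, ∃ b ∉ Y, G.Adj a b

/-- Cover a path in `K` from `x` to a vertex with a neighbour outside `Y` by finitely many sets `U`;
let `D₀` be the component of `x` in the part of their union inside `K`. Absorb the components of `K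
\ D₀` without an edge out of `Y`: this adds only boundary edges of `K` inside `Y`, which are
finitely many. The other components remain as pieces. -/
theorem IsPiece.exists_core {Y K : Set V} (hU : ∀ x ∈ Y, ∃ U ⊆ Y, x ∈ U ∧ FinCut G U)
    (hK : IsPiece G Y K) {x : V} (hx : x ∈ K) :
    ∃ D ⊆ K, x ∈ D ∧ IsConn G D ∧ FinCut G D ∧ (∃ a ∈ D, ∃ b ∉ Y, G.Adj a b) ∧
      ∀ y ∈ K, y ∉ D → IsPiece G Y (comp G (K \ D) y) := by
  choose! U hUY hxU hUf using hU
  obtain ⟨a, ha, b, hb, hab⟩ := hK.exists_adj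
  obtain ⟨p⟩ := hK.conn x hx a ha
  have hpK : ∀ z ∈ p.support, z ∈ K := by
    intro z hz
    classical
    by_contra hzK
    obtain ⟨c, d, -, hd, hcd⟩ := Reachable.exists_adj_boundary ⟨p.takeUntil z hz⟩ hx hzK
    exact hd hcd.2.2
  set U' : Set V := ⋃ z ∈ {z | z ∈ p.support}, U z with hU'
  have hU'f : FinCut G U' :=
    FinCut.biUnion (List.finite_toSet p.support) fun z hz => hUf z (hK.subset (hpK z hz))
  have hU'Y : U' ⊆ Y := Set.iUnion₂_subset fun z hz => hUY z (hK.subset (hpK z hz))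
  set E := U' ∩ K with hE
  have hpE : ∀ z ∈ p.support, z ∈ E := fun z hz =>
    ⟨Set.mem_biUnion (show z ∈ {z | z ∈ p.support} from hz) (hxU z (hK.subset (hpK z hz))),
      hpK z hz⟩
  have hEf : FinCut G E := FinCut.of_subset (Set.Finite.union hU'f hK.finCut) fun u v hu hv huv => by
    by_cases hvU : v ∈ U'
    · exact Or.inr (mem_cutEdges.2 ⟨⟨huv, hK.subset hu.2, hU'Y hvU⟩,
        Or.inl ⟨hu.2, fun h => hv ⟨hvU, h⟩⟩⟩)
    · exact Or.inl (mem_cutEdges.2 ⟨huv, Or.inl ⟨hu.1, hvU⟩⟩)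
  have hxE : x ∈ E := hpE x p.start_mem_support
  set D₀ := comp G E x with hD₀
  have hD₀E : D₀ ⊆ E := comp_subset hxE
  have hD₀K : D₀ ⊆ K := fun z hz => (hD₀E hz).2
  have haD : a ∈ D₀ := by
    refine ⟨p.transfer (G.within E) fun e he => ?_⟩
    induction e using Sym2.ind with
    | _ c d =>
      exact ⟨(p.adj_of_mem_edges he).1, hpE _ (p.fst_mem_support_of_mem_edges he),
        hpE _ (p.snd_mem_support_of_mem_edges he)⟩
  have hD₀f : FinCut G D₀ := hEf.comp hxE
  have hD₀c : IsConn G D₀ := isConn_comp hxE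
  have hxD₀ : x ∈ D₀ := self_mem_comp _ _
  -- The components of `K \ D₀` with an edge out of `Y`; the core will be `K \ T`.
  set T : Set V := {y | y ∈ K \ D₀ ∧ ∃ c ∈ comp G (K \ D₀) y, ∃ b ∉ Y, G.Adj c b} with hT
  have hTK : T ⊆ K := fun z hz => hz.1.1
  have hTsat : ∀ {y z}, y ∈ K \ D₀ → z ∈ comp G (K \ D₀) y → (z ∈ T ↔ y ∈ T) := by
    intro y z hy hz
    simp only [hT, Set.mem_ofPred_eq, comp_eq_of_mem hz, hy, comp_subset hy hz, true_and]
  have hD₀D : D₀ ⊆ K \ T := fun z hz => ⟨hD₀K hz, fun h => h.1.2 hz⟩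
  have hDf : FinCut G (K \ T) := FinCut.of_subset (Set.Finite.union hD₀f hK.finCut) fun u v hu hv huv => by
    by_cases huD : u ∈ D₀
    · exact Or.inl (mem_cutEdges.2 ⟨huv, Or.inl ⟨huD, fun h => hv (hD₀D h)⟩⟩)
    · have hu' : u ∈ K \ D₀ := ⟨hu.1, huD⟩
      by_cases hvK : v ∈ K
      · have hvT : v ∈ T := by
          by_contra h
          exact hv ⟨hvK, h⟩
        exact (hu.2 ((hTsat hu' (mem_comp_of_adj (self_mem_comp _ _) hu' hvT.1 huv)).1 hvT)).elim
      · have hvY : v ∈ Y := by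
          by_contra h
          exact hu.2 ⟨hu', u, self_mem_comp _ _, v, h, huv⟩
        exact Or.inr (mem_cutEdges.2 ⟨⟨huv, hK.subset hu.1, hvY⟩, Or.inl ⟨hu.1, hvK⟩⟩)
  refine ⟨K \ T, Set.sdiff_subset, hD₀D hxD₀, ?_, hDf, ⟨a, hD₀D haD, b, hb, hab⟩, ?_⟩
  · refine isConn_of_boundary (hD₀D hxD₀) fun D' hxD' hD' hne => ?_
    by_cases hsub : D₀ ⊆ D'
    · obtain ⟨y, hy, hyD'⟩ := Set.exists_of_ssubset (hD'.ssubset_of_ne hne)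
      have hy' : y ∈ K \ D₀ := ⟨hy.1, fun h => hyD' (hsub h)⟩
      have hQK := comp_subset (G := G) hy'
      obtain ⟨c, d, hcK, hdK, hc, hd, hcd⟩ := hK.conn.exists_boundary hy.1 hx
        (self_mem_comp (G := G) (K \ D₀) y) (fun h => (hQK h).2 hxD₀)
      have hdD₀ : d ∈ D₀ := by
        by_contra h
        exact hd (mem_comp_of_adj hc (hQK hc) ⟨hdK, h⟩ hcd)
      have hQD : ∀ z ∈ comp G (K \ D₀) y, z ∈ K \ T := fun z hz =>
        ⟨(hQK hz).1, fun h => hy.2 ((hTsat hy' hz).1 h)⟩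
      by_cases hcD' : c ∈ D'
      · obtain ⟨e, f, -, hf, he, hf', hef⟩ :=
          (isConn_comp hy').exists_boundary hc (self_mem_comp _ _) hcD' hyD'
        exact ⟨e, f, he, hQD f hf, hf', hef⟩
      · exact ⟨d, c, hsub hdD₀, hQD c hc, hcD', hcd.symm⟩
    · obtain ⟨z, hz, hzD'⟩ := Set.not_subset.1 hsub
      obtain ⟨e, f, -, hf, he, hf', hef⟩ := hD₀c.exists_boundary hxD₀ hz hxD' hzD'
      exact ⟨e, f, he, hD₀D hf, hf', hef⟩
  · intro y hyK hyD
    have hyT : y ∈ T := by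
      by_contra h
      exact hyD ⟨hyK, h⟩
    rw [Set.sdiff_sdiff_right_self, Set.inter_eq_self_of_subset_right hTK]
    have hsub := comp_subset (G := G) hyT
    refine ⟨(hsub.trans hTK).trans hK.subset, isConn_comp hyT, ?_, ?_⟩
    · refine FinCut.of_subset (Set.Finite.union hDf hK.finCut) fun u v hu hv huv => ?_
      by_cases hvK : v ∈ K
      · have hvT : v ∉ T := fun h => hv (mem_comp_of_adj hu (hsub hu) h huv.1)
        exact Or.inl (mem_cutEdges.2 ⟨huv.1, Or.inr ⟨fun h => h.2 (hsub hu), hvK, hvT⟩⟩)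
      · exact Or.inr (mem_cutEdges.2 ⟨huv, Or.inl ⟨hTK (hsub hu), hvK⟩⟩)
    · obtain ⟨c, hc, b, hb, hcb⟩ := hyT.2
      refine ⟨c, ?_, b, hb, hcb⟩
      exact (isConn_comp hyT.1).subset_comp (fun z hz => (hTsat hyT.1 hz).2 hyT)
        (self_mem_comp _ _) hc

/-- In a connected graph, a proper subset `Y` that is covered by subsets of finite boundary can be
partitioned into connected sets of finite boundary, each with an edge to the outside of `Y`. -/
theorem exists_partition (hG : G.Connected) {Y : Set V} (hY : Y ≠ Set.univ)
    (hU : ∀ x ∈ Y, ∃ U ⊆ Y, x ∈ U ∧ FinCut G U) :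
    ∃ part : V → Set V, ∀ x ∈ Y, x ∈ part x ∧ part x ⊆ Y ∧ IsConn G (part x) ∧
      FinCut G (part x) ∧ (∃ a ∈ part x, ∃ b ∉ Y, G.Adj a b) ∧ ∀ y ∈ part x, part y = part x := by
  -- Building the core around a vertex of `K` of least root distance in `G.within Y` makes the
  -- iterated cores exhaust `Y`.
  have hcore : ∀ K, IsPiece G Y K → ∃ D ⊆ K, IsConn G D ∧ FinCut G D ∧
      (∃ a ∈ D, ∃ b ∉ Y, G.Adj a b) ∧ (∀ y ∈ K, y ∉ D → IsPiece G Y (comp G (K \ D) y)) ∧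
      ∃ r ∈ K, r ∈ D ∧ ∀ z ∈ K, rootDist (G.within Y) r ≤ rootDist (G.within Y) z := by
    intro K hK
    obtain ⟨a, ha, -⟩ := hK.exists_adj
    obtain ⟨r, hr, hmin⟩ := WellFounded.has_min (measure (rootDist (G.within Y))).wf K ⟨a, ha⟩
    obtain ⟨D, h1, h2, h3, h4, h5, h6⟩ := hK.exists_core hU hr
    exact ⟨D, h1, h3, h4, h5, h6, r, hr, h2, fun z hz => not_lt.1 (hmin z hz)⟩
  choose! core h1 h2 h3 h4 h5 h6 using hcore
  let σ : Splitting V :=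
    { Good := IsPiece G Y
      core := core
      part := fun K y => comp G (K \ core K) y
      mem_part := fun _ _ _ => self_mem_comp _ _
      part_subset := fun _ hx hxc => comp_subset ⟨hx, hxc⟩
      good_part := fun hK hx hxc => h5 _ hK _ hx hxc
      part_eq := fun _ _ _ hy => comp_eq_of_mem hy }
  obtain ⟨w, hw⟩ := (Set.ne_univ_iff_exists_notMem Y).1 hY
  have hroot : ∀ x ∈ Y, IsPiece G Y (comp G Y x) := by
    intro x hx
    refine ⟨comp_subset hx, isConn_comp hx, ?_, ?_⟩
    · exact FinCut.of_subset Set.finite_empty fun u v hu hv huv =>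
        (hv (mem_comp_of_adj hu huv.2.1 huv.2.2 huv.1)).elim
    · obtain ⟨a, b, ha, hb, hab⟩ := (hG.preconnected x w).exists_adj_boundary
        (self_mem_comp (G := G) Y x) (fun h => hw (comp_subset hx h))
      exact ⟨a, ha, b, fun h => hb (mem_comp_of_adj ha (comp_subset hx ha) h hab), hab⟩
  have hlast : ∀ x ∈ Y, ∃ N, σ.IsNode (comp G Y x) N ∧ x ∈ core N := by
    intro x hx
    obtain ⟨n, h, h', h''⟩ := Splitting.exists_last_node (σ := σ) (hroot x hx) (self_mem_comp _ _)
      (Splitting.exists_mem_core (σ := σ) (hroot x hx) (G.within Y) (fun K hK => hK.finCut)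
        (fun K hK u hu v hv => (hK.conn u hu v hv).mono (within_mono hK.subset))
        (fun K hK _ => h6 K hK) (self_mem_comp _ _))
    exact ⟨_, h'', h'⟩
  choose! N hN hxN using hlast
  have hgood : ∀ x ∈ Y, IsPiece G Y (N x) := fun x hx => (hN x hx).good (σ := σ) (hroot x hx)
  refine ⟨fun x => core (N x), fun x hx => ⟨hxN x hx, (h1 _ (hgood x hx)).trans (hgood x hx).subset,
    h2 _ (hgood x hx), h3 _ (hgood x hx), h4 _ (hgood x hx), fun y hy => ?_⟩⟩
  have hyN : y ∈ N x := h1 _ (hgood x hx) hy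
  have hyY : y ∈ Y := (hgood x hx).subset hyN
  have hyx : comp G Y y = comp G Y x :=
    comp_eq_of_mem ((hN x hx).subset (σ := σ) (hroot x hx) hyN)
  have hNy := hN y hyY
  rw [hyx] at hNy
  exact congrArg core (hNy.eq_of_mem_core (σ := σ) (hroot x hx) (hN x hx)
    (h1 _ (hgood y hyY) (hxN y hyY)) hyN (hxN y hyY) hy)

end SimpleGraph

namespace SimpleGraph

open Filter Topology

variable {V W : Type u} {G : SimpleGraph V} {T : SimpleGraph W}

/-! ### Decreasing sequences of connected sets -/

theorem exists_forall_disjoint {S : ℕ → Set V} (hS : Antitone S) (h : ⋂ n, S n = ∅) {F : Set V}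
    (hF : F.Finite) : ∃ N, ∀ n ≥ N, ∀ x ∈ F, x ∉ S n := by
  have h1 : ∀ x, ∀ᶠ n in atTop, x ∉ S n := by
    intro x
    have hx : x ∉ ⋂ n, S n := by simp [h]
    obtain ⟨N, hN⟩ := not_forall.1 (fun hc => hx (Set.mem_iInter.2 hc))
    exact eventually_atTop.2 ⟨N, fun n hn hx => hN (hS hn hx)⟩
  exact eventually_atTop.1 ((eventually_all_finite hF).2 fun x _ => h1 x)

/-- Eventually `S n` misses the finitely many ends of boundary edges of `D`; being connected, it
then cannot meet both sides. -/
theorem exists_forall_subset_or {S : ℕ → Set V} (hS : Antitone S) (h : ⋂ n, S n = ∅)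
    (hc : ∀ n, IsConn G (S n)) {D : Set V} (hD : FinCut G D) :
    ∃ N, ∀ n ≥ N, S n ⊆ D ∨ S n ⊆ Dᶜ := by
  obtain ⟨N, hN⟩ := exists_forall_disjoint hS h hD.finite_cutVerts
  refine ⟨N, fun n hn => ?_⟩
  by_contra! hcon
  obtain ⟨y, hy, hyD⟩ := Set.not_subset.1 hcon.1
  obtain ⟨x, hx, hxD⟩ := Set.not_subset.1 hcon.2
  obtain ⟨a, ha, ha'⟩ := (hc n).exists_mem_cutVerts hx hy (not_not.1 hxD) hyD
  exact hN n hn a ha' ha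

/-! ### Sides of the edges of a tree -/

/-- The side of `b` after the deletion of the edge `ab`. -/
def side (T : SimpleGraph W) (a b : W) : Set W := {x | (T.deleteEdges {s(a, b)}).Reachable b x}

theorem right_mem_side (a b : W) : b ∈ side T a b := Reachable.refl _

theorem eq_of_side_boundary {a b x y : W} (hx : x ∈ side T a b) (hy : y ∉ side T a b)
    (hxy : T.Adj x y) : s(x, y) = s(a, b) := by
  by_contra h
  exact hy (Reachable.trans hx (Adj.reachable (by rw [deleteEdges_adj]; exact ⟨hxy, h⟩)))

theorem finCut_side (a b : W) : FinCut T (side T a b) :=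
  FinCut.of_subset (Set.finite_singleton s(a, b)) fun _ _ hx hy hxy => eq_of_side_boundary hx hy hxy

theorem isConn_side (a b : W) : IsConn T (side T a b) := by
  refine isConn_of_boundary (right_mem_side a b) fun D hb hD hne => ?_
  obtain ⟨y, hy, hyD⟩ := Set.exists_of_ssubset (hD.ssubset_of_ne hne)
  obtain ⟨u, v, hu, hv, huv⟩ := Reachable.exists_adj_boundary hy hb hyD
  exact ⟨u, v, hu, Reachable.trans (hD hu) huv.reachable, hv, (deleteEdges_adj.1 huv).1⟩

theorem IsTree.left_notMem_side (hT : T.IsTree) {a b : W} (h : T.Adj a b) : a ∉ side T a b := by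
  have := isAcyclic_iff_forall_adj_isBridge.1 hT.isAcyclic h
  exact fun hc => isBridge_iff.1 this (Reachable.symm hc)

theorem IsTree.eq_of_side_boundary (hT : T.IsTree) {a b x y : W} (h : T.Adj a b)
    (hx : x ∈ side T a b) (hy : y ∉ side T a b) (hxy : T.Adj x y) : x = b ∧ y = a := by
  rcases Sym2.eq_iff.1 (SimpleGraph.eq_of_side_boundary hx hy hxy) with ⟨rfl, rfl⟩ | ⟨rfl, rfl⟩
  · exact (hT.left_notMem_side h hx).elim
  · exact ⟨rfl, rfl⟩

theorem IsTree.compl_side (hT : T.IsTree) {a b : W} (h : T.Adj a b) :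
    (side T a b)ᶜ = side T b a := by
  ext x
  constructor
  · intro hx
    by_contra hx'
    obtain ⟨u, v, hu, hv, huv⟩ := (hT.connected.preconnected x a).exists_adj_boundary
      (D := {z | z ∉ side T a b ∧ z ∉ side T b a}) ⟨hx, hx'⟩ (fun h => h.2 (right_mem_side b a))
    by_cases hvs : v ∈ side T a b
    · have := (hT.eq_of_side_boundary h hvs hu.1 huv.symm).2
      exact hu.2 (this.symm ▸ right_mem_side b a)
    · have hvs' : v ∈ side T b a := by
        by_contra h'
        exact hv ⟨hvs, h'⟩
      have := (hT.eq_of_side_boundary h.symm hvs' hu.2 huv.symm).2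
      exact hu.1 (this.symm ▸ right_mem_side a b)
  · intro hx hx'
    have h1 : (T.deleteEdges {s(a, b)}).Reachable a x := by
      have : s(a, b) = s(b, a) := Sym2.eq_swap
      rw [this]; exact hx
    exact hT.left_notMem_side h (Reachable.trans hx' h1.symm)

/-- A path inside `side T t d` from a common vertex to `d` would have to leave `side T t c` through
`t`, which is not in `side T t d`. -/
theorem IsTree.disjoint_side (hT : T.IsTree) {t c d : W} (hc : T.Adj t c) (hd : T.Adj t d)
    (hcd : c ≠ d) : Disjoint (side T t c) (side T t d) := by
  rw [Set.disjoint_left]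
  intro x hxc hxd
  have hd' : d ∉ side T t c := fun h =>
    hcd (hT.eq_of_side_boundary hc h (hT.left_notMem_side hc) hd.symm).1.symm
  obtain ⟨a, b, -, hb, ha, hb', hab⟩ :=
    (isConn_side t d).exists_boundary hxd (right_mem_side t d) hxc hd'
  exact hT.left_notMem_side hd ((hT.eq_of_side_boundary hc ha hb' hab).2 ▸ hb)

theorem IsTree.exists_mem_side (hT : T.IsTree) {t x : W} (h : t ≠ x) :
    ∃ c, T.Adj t c ∧ x ∈ side T t c := by
  obtain ⟨p, hp⟩ := (hT.connected.preconnected t x).exists_isPath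
  cases p with
  | nil => exact (h rfl).elim
  | @cons _ c _ hadj q =>
    rw [Walk.cons_isPath_iff] at hp
    exact ⟨c, hadj, reachable_deleteEdges_iff_exists_walk.2
      ⟨q, fun hmem => hp.2 (q.fst_mem_support_of_mem_edges hmem)⟩⟩

/-! ### Walks in a tree that never turn back. -/

section Sequence

variable {t : ℕ → W}

theorem IsTree.antitone_side (hT : T.IsTree) (hadj : ∀ n, T.Adj (t n) (t (n + 1)))
    (hne : ∀ n, t (n + 2) ≠ t n) : Antitone fun n => side T (t n) (t (n + 1)) := by
  refine antitone_nat_of_succ_le fun n x hx => ?_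
  by_contra h
  have h' : x ∈ side T (t (n + 1)) (t n) := hT.compl_side (hadj n) ▸ h
  exact Set.disjoint_left.1 (hT.disjoint_side (hadj (n + 1)) (hadj n).symm (hne n)) hx h'

theorem IsTree.injective_of_ne (hT : T.IsTree) (hadj : ∀ n, T.Adj (t n) (t (n + 1)))
    (hne : ∀ n, t (n + 2) ≠ t n) : Function.Injective t := by
  have key : ∀ m n, m < n → t m ≠ t n := by
    intro m n hmn h
    obtain ⟨k, rfl⟩ := Nat.exists_eq_add_of_lt hmn
    have h2 : t (m + k + 1) ∈ side T (t m) (t (m + 1)) :=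
      hT.antitone_side hadj hne (Nat.le_add_right m k) (right_mem_side _ _)
    exact hT.left_notMem_side (hadj m) (h.symm ▸ h2)
  intro m n h
  rcases lt_trichotomy m n with hmn | hmn | hmn
  · exact (key m n hmn h).elim
  · exact hmn
  · exact (key n m hmn h.symm).elim

/-- A walk from a common vertex to `t 0` leaves each side through its only boundary edge, so it
would visit the infinitely many vertices `t n`. -/
theorem IsTree.iInter_side (hT : T.IsTree) (hadj : ∀ n, T.Adj (t n) (t (n + 1)))
    (hne : ∀ n, t (n + 2) ≠ t n) : ⋂ n, side T (t n) (t (n + 1)) = ∅ := by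
  refine Set.eq_empty_of_forall_notMem fun x hx => ?_
  rw [Set.mem_iInter] at hx
  obtain ⟨p⟩ := hT.connected.preconnected x (t 0)
  refine Set.infinite_of_injective_forall_mem (hT.injective_of_ne hadj hne) (fun n => ?_)
    (List.finite_toSet p.support)
  have h0 : t 0 ∉ side T (t n) (t (n + 1)) := fun h =>
    hT.left_notMem_side (hadj 0) (hT.antitone_side hadj hne (Nat.zero_le n) h)
  obtain ⟨d, hd, h1, h2⟩ := p.exists_boundary_dart _ (hx n) h0
  have := (hT.eq_of_side_boundary (hadj n) h1 h2 d.adj).2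
  exact this ▸ p.dart_snd_mem_support_of_mem_darts hd

end Sequence

/-! ### Separation and compactness of `‖T‖`. -/

theorem EdgeRay.ne_add_two (R : EdgeRay G) (n : ℕ) : R.vert (n + 2) ≠ R.vert n :=
  fun h => by have := R.injective h; omega

theorem EdgeRay.eventually_mem_side (hT : T.IsTree) (R : EdgeRay T) (n : ℕ) :
    ∀ᶠ m in atTop, R.vert m ∈ side T (R.vert n) (R.vert (n + 1)) := by
  refine eventually_atTop.2 ⟨n + 1, fun m hm => ?_⟩
  obtain ⟨k, rfl⟩ := Nat.exists_eq_add_of_le' (Nat.le_of_succ_le hm)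
  obtain ⟨j, rfl⟩ : ∃ j, k = j + 1 := ⟨k - 1, by omega⟩
  have := hT.antitone_side R.adj R.ne_add_two (Nat.le_add_left n j)
  have h2 := this (right_mem_side _ _)
  rwa [show j + 1 + n = j + n + 1 by omega]

/-- In a tree, sets of finite boundary separate the vertices and ends. -/
theorem IsTree.exists_finCut_of_ne (hT : T.IsTree) {p q : VertexEnd T} (h : p ≠ q) :
    ∃ U, FinCut T U ∧ p ∈ VertexEnd.hull T U ∧ q ∉ VertexEnd.hull T U := by
  have hve : ∀ (v : W) (ω : EdgeEnd T), ∃ U, FinCut T U ∧ v ∉ U ∧ ω.LivesIn U := by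
    intro v ω
    obtain ⟨R, rfl⟩ := ω.exists_ray
    obtain ⟨n, hn⟩ : ∃ n, v ∉ side T (R.vert n) (R.vert (n + 1)) := by
      by_contra! hc
      exact Set.notMem_empty v (hT.iInter_side R.adj R.ne_add_two ▸ Set.mem_iInter.2 hc)
    exact ⟨_, finCut_side _ _, hn, (R.livesIn_iff (finCut_side _ _)).2 (R.eventually_mem_side hT n)⟩
  cases p with
  | vertex v =>
    cases q with
    | vertex w =>
      have hvw : v ≠ w := fun h' => h (h' ▸ rfl)
      obtain ⟨c, hc, hw⟩ := hT.exists_mem_side hvw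
      exact ⟨(side T v c)ᶜ, (finCut_side _ _).compl,
        VertexEnd.vertex_mem_hull.2 (hT.left_notMem_side hc),
        fun h' => VertexEnd.vertex_mem_hull.1 h' hw⟩
    | edgeEnd ω =>
      obtain ⟨U, hU, hv, hω⟩ := hve v ω
      exact ⟨Uᶜ, hU.compl, VertexEnd.vertex_mem_hull.2 hv, fun h' =>
        (VertexEnd.mem_hull_compl_iff hU).1 h' (VertexEnd.edgeEnd_mem_hull.2 hω)⟩
  | edgeEnd ω =>
    cases q with
    | vertex w =>
      obtain ⟨U, hU, hv, hω⟩ := hve w ω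
      exact ⟨U, hU, VertexEnd.edgeEnd_mem_hull.2 hω, fun h' => hv (VertexEnd.vertex_mem_hull.1 h')⟩
    | edgeEnd ω' =>
      obtain ⟨U, hU, h1, h2⟩ := EdgeEnd.exists_finCut_of_ne (fun h' : ω = ω' => h (h' ▸ rfl))
      exact ⟨U, hU, VertexEnd.edgeEnd_mem_hull.2 h1,
        fun h' => h2 (VertexEnd.edgeEnd_mem_hull.1 h')⟩

theorem EdgeRay.exists_side_subset (hT : T.IsTree) (R : EdgeRay T) {U : Set W} (hU : FinCut T U)
    (h : ∀ᶠ n in atTop, R.vert n ∈ U) :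
    ∃ N, ∀ n ≥ N, side T (R.vert n) (R.vert (n + 1)) ⊆ U := by
  obtain ⟨N, hN⟩ := exists_forall_subset_or (hT.antitone_side R.adj R.ne_add_two)
    (hT.iInter_side R.adj R.ne_add_two) (fun n => isConn_side _ _) hU
  obtain ⟨M, hM⟩ := eventually_atTop.1 h
  refine ⟨max N M, fun n hn => (hN n (le_trans (le_max_left _ _) hn)).resolve_right fun hc => ?_⟩
  exact hc (right_mem_side _ _) (hM (n + 1) (by have := le_max_right N M; omega))

/-- Every ultrafilter on the vertices of a tree converges to a vertex or end. -/
theorem IsTree.exists_forall_mem_iff (hT : T.IsTree) (𝓤 : Ultrafilter W) :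
    ∃ p : VertexEnd T, ∀ U, FinCut T U → (U ∈ 𝓤 ↔ p ∈ VertexEnd.hull T U) := by
  suffices h : ∃ p : VertexEnd T, ∀ U, FinCut T U → p ∈ VertexEnd.hull T U → U ∈ 𝓤 by
    obtain ⟨p, hp⟩ := h
    refine ⟨p, fun U hU => ⟨fun h => ?_, hp U hU⟩⟩
    by_contra hc
    exact Ultrafilter.compl_mem_iff_notMem.1
      (hp _ hU.compl ((VertexEnd.mem_hull_compl_iff hU).2 hc)) h
  by_cases hcase : ∃ t, ∀ c, T.Adj t c → side T t c ∉ 𝓤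
  · obtain ⟨t, ht⟩ := hcase
    refine ⟨VertexEnd.vertex t, fun U hU htU => ?_⟩
    rw [VertexEnd.vertex_mem_hull] at htU
    by_contra hUn
    rw [← Ultrafilter.compl_mem_iff_notMem] at hUn
    -- A side at `t` that meets `Uᶜ` contains an end of a boundary edge of `U`. Sides at `t` are
    -- disjoint, so finitely many of them cover `Uᶜ`, and none belongs to `𝓤`.
    set C : Set W := ⋃ f ∈ cutVerts T U, {c | T.Adj t c ∧ f ∈ side T t c} with hC
    have hCf : C.Finite := by
      refine hU.finite_cutVerts.biUnion fun f _ => Set.Subsingleton.finite fun c hc d hd => ?_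
      by_contra hcd
      exact Set.disjoint_left.1 (hT.disjoint_side hc.1 hd.1 hcd) hc.2 hd.2
    have hsub : Uᶜ ⊆ ⋃ c ∈ C, side T t c := by
      intro x hx
      obtain ⟨c, hc, hxc⟩ := hT.exists_mem_side (t := t) (x := x) (fun h => hx (h ▸ htU))
      have : ∃ f ∈ side T t c, f ∈ cutVerts T U := by
        by_cases hcU : c ∈ U
        · exact (isConn_side t c).exists_mem_cutVerts (right_mem_side t c) hxc hcU hx
        · exact ⟨c, right_mem_side t c, t, mem_cutEdges.2 ⟨hc.symm, Or.inr ⟨hcU, htU⟩⟩⟩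
      obtain ⟨f, hf, hfU⟩ := this
      exact Set.mem_biUnion (Set.mem_biUnion hfU ⟨hc, hf⟩) hxc
    obtain ⟨c, hc, hc'⟩ := (Ultrafilter.finite_biUnion_mem_iff hCf).1 (mem_of_superset hUn hsub)
    obtain ⟨f, -, hf⟩ := Set.mem_iUnion₂.1 hc
    exact ht c hf.1 hc'
  -- Now each `t` has a neighbour `f t` whose side is in `𝓤`. Iterating `f` never turns back, since
  -- the two sides of an edge are complementary, and so traces a ray to whose end `𝓤` converges.
  · push Not at hcase
    choose f hadj hf using hcase
    obtain ⟨t₀⟩ := hT.connected.nonempty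
    have hadj' : ∀ n, T.Adj (f^[n] t₀) (f^[n + 1] t₀) := fun n => by
      rw [Function.iterate_succ_apply']
      exact hadj _
    have hne : ∀ n, f^[n + 2] t₀ ≠ f^[n] t₀ := fun n h => by
      rw [Function.iterate_succ_apply', Function.iterate_succ_apply'] at h
      have h1 := hf (f^[n] t₀)
      have h2 := hf (f (f^[n] t₀))
      rw [h, ← hT.compl_side (hadj _)] at h2
      exact Ultrafilter.compl_mem_iff_notMem.1 h2 h1
    let R : EdgeRay T := ⟨fun n => f^[n] t₀, hT.injective_of_ne hadj' hne, hadj'⟩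
    refine ⟨VertexEnd.edgeEnd R.toEnd, fun U hU h => ?_⟩
    rw [VertexEnd.edgeEnd_mem_hull, R.livesIn_iff hU] at h
    obtain ⟨N, hN⟩ := R.exists_side_subset hT hU h
    refine mem_of_superset ?_ (hN N le_rfl)
    have := hf (f^[N] t₀)
    rwa [← Function.iterate_succ_apply' f] at this

/-! ### Comparing an edge-end space with a tree -/

/-- If the preimages under `π : V(G) → V(T)` of the sets of finite boundary of the tree `T` are
exactly the sets of finite boundary of `G`, then `Ω_E(G)` embeds in `‖T‖`. -/
theorem exists_isEmbedding (hT : T.IsTree) (π : V → W)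
    (hpre : ∀ U, FinCut T U → FinCut G (π ⁻¹' U))
    (hsurj : ∀ D, FinCut G D → ∃ U, FinCut T U ∧ D = π ⁻¹' U) :
    ∃ Φ : EdgeEnd G → VertexEnd T, IsEmbedding Φ ∧
      ∀ ω U, FinCut T U → (Φ ω ∈ VertexEnd.hull T U ↔ ω.LivesIn (π ⁻¹' U)) := by
  have key : ∀ ω : EdgeEnd G, ∃ p : VertexEnd T, ∀ U, FinCut T U →
      (p ∈ VertexEnd.hull T U ↔ ω.LivesIn (π ⁻¹' U)) := by
    intro ω
    obtain ⟨R, rfl⟩ := ω.exists_ray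
    -- The image of the end is an ultrafilter limit along `π ∘ R`: what holds on a tail of `R` holds
    -- for the hyperfilter, and passing to complements gives the converse.
    obtain ⟨p, hp⟩ := hT.exists_forall_mem_iff ((hyperfilter ℕ).map (π ∘ R.vert))
    have h1 : ∀ U, FinCut T U → R.toEnd.LivesIn (π ⁻¹' U) → p ∈ VertexEnd.hull T U := by
      intro U hU h
      rw [R.livesIn_iff (hpre U hU)] at h
      exact (hp U hU).1 (Ultrafilter.mem_map.2 (Nat.hyperfilter_le_atTop h))
    refine ⟨p, fun U hU => ⟨fun h => ?_, h1 U hU⟩⟩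
    by_contra hc
    rw [← EdgeEnd.livesIn_compl_iff _ (hpre U hU)] at hc
    exact (VertexEnd.mem_hull_compl_iff hU).1 (h1 _ hU.compl hc) h
  choose Φ hΦ using key
  refine ⟨Φ, ⟨⟨?_⟩, fun ω ω' h => ?_⟩, hΦ⟩
  · rw [EdgeEnd.topology_eq_generateFrom_finCut, VertexEnd.topology_eq_generateFrom_finCut,
      induced_generateFrom_eq]
    congr 1
    ext S
    constructor
    · rintro ⟨D, hD, rfl⟩
      obtain ⟨U, hU, rfl⟩ := hsurj D hD
      exact ⟨_, ⟨U, hU, rfl⟩, Set.ext fun ω => hΦ ω U hU⟩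
    · rintro ⟨_, ⟨U, hU, rfl⟩, rfl⟩
      exact ⟨_, hpre U hU, Set.ext fun ω => hΦ ω U hU⟩
  · by_contra hne
    obtain ⟨D, hD, h1, h2⟩ := EdgeEnd.exists_finCut_of_ne hne
    obtain ⟨U, hU, rfl⟩ := hsurj D hD
    rw [← hΦ _ U hU] at h1 h2
    exact h2 (h ▸ h1)

theorem IsTree.eq_of_forall_mem_hull (hT : T.IsTree) {p q : VertexEnd T}
    (h : ∀ U, FinCut T U → p ∈ VertexEnd.hull T U → q ∈ VertexEnd.hull T U) : p = q := by
  by_contra hne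
  obtain ⟨U, hU, h1, h2⟩ := hT.exists_finCut_of_ne hne
  exact h2 (h U hU h1)

end SimpleGraph

/-! ### From trees to graphs: blowing up vertices to infinite cliques. -/

namespace SimpleGraph

open Filter Topology

variable {W : Type u} {T : SimpleGraph W} {X : Set W}

/-- The graph obtained from `T` by enlarging each vertex in `X` to an infinite clique. -/
def cliqueBlowup (T : SimpleGraph W) (X : Set W) :
    SimpleGraph {p : W × ℕ // p.2 = 0 ∨ p.1 ∈ X} where
  Adj p q := (p.1.1 = q.1.1 ∧ p ≠ q) ∨ (p.1.2 = 0 ∧ q.1.2 = 0 ∧ T.Adj p.1.1 q.1.1)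
  symm := ⟨fun _ _ h => h.imp (fun h => ⟨h.1.symm, h.2.symm⟩) fun h => ⟨h.2.1, h.1, h.2.2.symm⟩⟩
  loopless := ⟨fun _ h => h.elim (fun h => h.2 rfl) fun h => h.2.2.ne rfl⟩

namespace cliqueBlowup

/-- The vertex of `T` in its blowup. -/
def base (X : Set W) (w : W) : {p : W × ℕ // p.2 = 0 ∨ p.1 ∈ X} := ⟨(w, 0), Or.inl rfl⟩

/-- The projection of the blowup to `T`. -/
def proj (X : Set W) (p : {p : W × ℕ // p.2 = 0 ∨ p.1 ∈ X}) : W := p.1.1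

theorem base_injective : Function.Injective (base X) := fun _ _ h =>
  congrArg (proj X) h

theorem eq_base_of_notMem {p : {p : W × ℕ // p.2 = 0 ∨ p.1 ∈ X}} (h : proj X p ∉ X) :
    p = base X (proj X p) := by
  obtain ⟨⟨w, n⟩, hn⟩ := p
  obtain rfl : n = 0 := hn.resolve_right h
  rfl

theorem adj_base {v w : W} (h : T.Adj v w) : (cliqueBlowup T X).Adj (base X v) (base X w) :=
  Or.inr ⟨rfl, rfl, h⟩

theorem connected (hT : T.Connected) : (cliqueBlowup T X).Connected := by
  obtain ⟨w₀⟩ := hT.nonempty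
  have : Nonempty {p : W × ℕ // p.2 = 0 ∨ p.1 ∈ X} := ⟨base X w₀⟩
  have h1 : ∀ p, (cliqueBlowup T X).Reachable (base X (proj X p)) p := by
    intro p
    by_cases h : base X (proj X p) = p
    · exact h ▸ Reachable.refl _
    · exact Adj.reachable (Or.inl ⟨rfl, h⟩)
  let f : T →g cliqueBlowup T X := ⟨base X, fun h => adj_base h⟩
  refine Connected.mk fun p q => (h1 p).symm.trans (Reachable.trans ?_ (h1 q))
  exact (hT.preconnected _ _).map f

theorem finCut_preimage {U : Set W} (hU : FinCut T U) :
    FinCut (cliqueBlowup T X) (proj X ⁻¹' U) := by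
  refine FinCut.of_subset (hU.image (Sym2.map (base X))) fun p q hp hq hpq => ?_
  rcases hpq with ⟨h, -⟩ | ⟨hp0, hq0, h⟩
  · exact (hq (show q.1.1 ∈ U from h ▸ hp)).elim
  · refine ⟨s(proj X p, proj X q), mem_cutEdges.2 ⟨h, Or.inl ⟨hp, hq⟩⟩, ?_⟩
    rw [Sym2.map_mk, show base X (proj X p) = p from Subtype.ext (Prod.ext rfl hp0.symm),
      show base X (proj X q) = q from Subtype.ext (Prod.ext rfl hq0.symm)]

/-- If `D` separated two vertices of an infinite clique, each vertex of the clique would be joined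
across the boundary to one of them. -/
theorem mem_iff_of_finCut {D : Set {p : W × ℕ // p.2 = 0 ∨ p.1 ∈ X}}
    (hD : FinCut (cliqueBlowup T X) D) (p : {p : W × ℕ // p.2 = 0 ∨ p.1 ∈ X}) :
    p ∈ D ↔ base X (proj X p) ∈ D := by
  by_contra h
  obtain ⟨⟨w, n⟩, hn⟩ := p
  have hw : w ∈ X := by
    by_contra hw
    obtain rfl : n = 0 := hn.resolve_right hw
    exact h Iff.rfl
  refine Set.infinite_of_injective_forall_mem
    (f := fun m : ℕ => (⟨(w, m), Or.inr hw⟩ : {p : W × ℕ // p.2 = 0 ∨ p.1 ∈ X}))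
    (fun a b hab => by simpa using hab) (fun m => ?_) hD.finite_cutVerts
  have key : ∀ q : {p : W × ℕ // p.2 = 0 ∨ p.1 ∈ X}, q.1.1 = w →
      ¬ ((⟨(w, m), Or.inr hw⟩ : {p : W × ℕ // p.2 = 0 ∨ p.1 ∈ X}) ∈ D ↔ q ∈ D) →
      (⟨(w, m), Or.inr hw⟩ : {p : W × ℕ // p.2 = 0 ∨ p.1 ∈ X})
        ∈ cutVerts (cliqueBlowup T X) D := by
    intro q hq hne
    refine ⟨q, mem_cutEdges.2 ⟨Or.inl ⟨hq.symm, fun h' => hne (h' ▸ Iff.rfl)⟩, ?_⟩⟩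
    tauto
  by_cases h1 : ((⟨(w, m), Or.inr hw⟩ : {p : W × ℕ // p.2 = 0 ∨ p.1 ∈ X}) ∈ D
      ↔ base X w ∈ D)
  · exact key ⟨(w, n), hn⟩ rfl fun h2 => h (h2.symm.trans h1)
  · exact key (base X w) rfl h1

theorem exists_finCut {D : Set {p : W × ℕ // p.2 = 0 ∨ p.1 ∈ X}}
    (hD : FinCut (cliqueBlowup T X) D) : ∃ U, FinCut T U ∧ D = proj X ⁻¹' U := by
  refine ⟨base X ⁻¹' D, ?_, Set.ext fun p => mem_iff_of_finCut hD p⟩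
  refine FinCut.of_subset (hD.image (Sym2.map (proj X))) fun v w hv hw hvw => ?_
  exact ⟨s(base X v, base X w), mem_cutEdges.2 ⟨adj_base hvw, Or.inl ⟨hv, hw⟩⟩, rfl⟩

/-- A ray of the blowup that avoids a vertex `w ∉ X` of the tree stays on one side of `w`. -/
theorem exists_side (hT : T.IsTree) (R : EdgeRay (cliqueBlowup T X)) {w : W} (hw : w ∉ X) :
    ∃ c, T.Adj w c ∧ ∀ᶠ n in atTop, R.vert n ∈ proj X ⁻¹' side T w c := by
  obtain ⟨N, hN⟩ : ∃ N, ∀ n ≥ N, proj X (R.vert n) ≠ w := by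
    by_contra! hc
    obtain ⟨n, -, hn⟩ := hc 0
    obtain ⟨m, hm, hm'⟩ := hc (n + 1)
    have h1 := eq_base_of_notMem (hn.symm ▸ hw)
    have h2 := eq_base_of_notMem (hm'.symm ▸ hw)
    rw [hn] at h1
    rw [hm'] at h2
    have := R.injective (h1.trans h2.symm)
    omega
  obtain ⟨c, hc, hNc⟩ := hT.exists_mem_side (hN N le_rfl).symm
  refine ⟨c, hc, eventually_atTop.2 ⟨N, fun n hn => ?_⟩⟩
  induction n, hn using Nat.le_induction with
  | base => exact hNc
  | succ n hn ih =>
    by_contra hcon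
    rcases R.adj n with ⟨h, -⟩ | ⟨-, -, h⟩
    · refine hcon ?_
      change (R.vert (n + 1)).1.1 ∈ side T w c
      rw [← h]
      exact ih
    · exact hN (n + 1) (by omega) (hT.eq_of_side_boundary hc ih hcon h).2

end cliqueBlowup

open cliqueBlowup in
/-- Every subspace of `‖T‖` that contains all ends of the tree `T` is the edge-end space of a
connected graph. -/
theorem IsTree.exists_homeomorph_edgeEnd (hT : T.IsTree) {X : Set (VertexEnd T)}
    (hX : ∀ ω : EdgeEnd T, VertexEnd.edgeEnd ω ∈ X) :
    ∃ (V : Type u) (G : SimpleGraph V), G.Connected ∧ Nonempty (EdgeEnd G ≃ₜ X) := by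
  set Y : Set W := {w | VertexEnd.vertex w ∈ X} with hY
  refine ⟨_, cliqueBlowup T Y, cliqueBlowup.connected hT.connected, ?_⟩
  obtain ⟨Φ, hΦ, hrel⟩ := exists_isEmbedding hT (proj Y)
    (fun U hU => finCut_preimage (X := Y) hU) (fun D hD => exists_finCut hD)
  have hmap : ∀ (R : EdgeRay (cliqueBlowup T Y)) (p : VertexEnd T),
      (∀ U, FinCut T U → p ∈ VertexEnd.hull T U → ∀ᶠ n in atTop, R.vert n ∈ proj Y ⁻¹' U) →
      Φ R.toEnd = p := fun R p h =>
    (hT.eq_of_forall_mem_hull fun U hU hp => (hrel _ U hU).2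
      ((R.livesIn_iff (finCut_preimage hU)).2 (h U hU hp))).symm
  have hrange : Set.range Φ = X := by
    ext p
    constructor
    · rintro ⟨ω, rfl⟩
      rcases hp : Φ ω with w | ω'
      -- For `w` outside `X`, a ray of `ω` settles on one side at `w`, and `Φ ω` would lie in the
      -- hull of a side that misses `w`.
      · by_contra hw
        obtain ⟨R, rfl⟩ := ω.exists_ray
        obtain ⟨c, hc, h⟩ := exists_side (X := Y) hT R hw
        have := (hrel _ _ (finCut_side w c)).2
          ((R.livesIn_iff (finCut_preimage (finCut_side w c))).2 h)
        rw [hp, VertexEnd.vertex_mem_hull] at this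
        exact hT.left_notMem_side hc this
      · exact hX ω'
    · intro hp
      cases p with
      | vertex w =>
        let R : EdgeRay (cliqueBlowup T Y) :=
          { vert := fun n => ⟨(w, n), Or.inr hp⟩
            injective := fun a b hab => by simpa using hab
            adj := fun n => Or.inl ⟨rfl, by simp⟩ }
        exact ⟨R.toEnd, hmap R _ fun U _ hw => Eventually.of_forall fun n =>
          show w ∈ U from VertexEnd.vertex_mem_hull.1 hw⟩
      | edgeEnd ω =>
        obtain ⟨S, rfl⟩ := ω.exists_ray
        let R : EdgeRay (cliqueBlowup T Y) :=
          { vert := fun n => base Y (S.vert n)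
            injective := base_injective.comp S.injective
            adj := fun n => adj_base (S.adj n) }
        exact ⟨R.toEnd, hmap R _ fun U hU h =>
          (S.livesIn_iff hU).1 (VertexEnd.edgeEnd_mem_hull.1 h)⟩
  exact ⟨hΦ.toHomeomorph.trans (Homeomorph.setCongr hrange)⟩

end SimpleGraph

/-! ### Rays through decreasing sequences of connected sets. -/

namespace SimpleGraph

open Filter Topology

variable {V W : Type u} {G : SimpleGraph V} {T : SimpleGraph W}

/-- A decreasing sequence of connected sets with empty intersection contains tails of a ray. -/
theorem exists_ray_of_antitone {S : ℕ → Set V} (hS : Antitone S) (hc : ∀ n, IsConn G (S n))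
    (hne : ∀ n, (S n).Nonempty) (hempty : ⋂ n, S n = ∅) :
    ∃ R : EdgeRay G, ∀ n, ∀ᶠ m in atTop, R.vert m ∈ S n := by
  classical
  have hν : ∀ v ∈ S 0, ∃ n, v ∈ S n ∧ v ∉ S (n + 1) := by
    by_contra! hcon
    obtain ⟨v, hv, h⟩ := hcon
    have : ∀ n, v ∈ S n := fun n => Nat.rec hv h n
    exact Set.notMem_empty v (hempty ▸ Set.mem_iInter.2 this)
  choose! ν hν1 hν2 using hν
  choose z hz using hne
  -- `ν v` is the last index with `v ∈ S (ν v)`; `δ v` is the distance inside that set to a chosen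
  -- vertex of the next one. A step along a shortest path raises `ν`, or keeps it and lowers `δ`: no
  -- vertex repeats and `ν` is unbounded.
  set δ : V → ℕ := fun v => (G.within (S (ν v))).dist (z (ν v + 1)) v with hδ
  have hf : ∀ v ∈ S 0, ∃ y ∈ S 0, G.Adj v y ∧ (ν v < ν y ∨ (ν v = ν y ∧ δ y < δ v)) := by
    intro v hv
    have hreach := hc (ν v) _ (hS (Nat.le_succ (ν v)) (hz (ν v + 1))) v (hν1 v hv)
    have hdist : δ v ≠ 0 := fun h0 => by
      have h := hz (ν v + 1)
      rw [hreach.dist_eq_zero_iff.1 h0] at h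
      exact hν2 v hv h
    obtain ⟨y, hy, hlt⟩ := hreach.exists_adj_dist_lt hdist
    have hy0 : y ∈ S 0 := hS (Nat.zero_le _) hy.2.2
    have hle : ν v ≤ ν y := by
      by_contra hcon
      exact hν2 y hy0 (hS (show ν y + 1 ≤ ν v by omega) hy.2.2)
    refine ⟨y, hy0, hy.1, hle.lt_or_eq.imp id fun h => ⟨h, ?_⟩⟩
    simp only [hδ, ← h]
    exact hlt
  choose! f hf0 hfadj hflt using hf
  obtain ⟨v₀, hv₀⟩ : (S 0).Nonempty := ⟨z 0, hz 0⟩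
  set u : ℕ → V := fun k => f^[k] v₀ with hu
  have hus : ∀ k, u (k + 1) = f (u k) := fun k => Function.iterate_succ_apply' f k v₀
  have hu0 : ∀ k, u k ∈ S 0 := by
    intro k
    induction k with
    | zero => exact hv₀
    | succ k ih => exact hus k ▸ hf0 _ ih
  have hlt : ∀ k, ν (u k) < ν (u (k + 1)) ∨ (ν (u k) = ν (u (k + 1)) ∧ δ (u (k + 1)) < δ (u k)) :=
    fun k => hus k ▸ hflt _ (hu0 k)
  have hmono : Monotone fun k => ν (u k) := monotone_nat_of_le_succ fun k => by
    rcases hlt k with h | h <;> omega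
  have hstrict : StrictMono fun k => toLex (ν (u k), OrderDual.toDual (δ (u k))) :=
    strictMono_nat_of_lt_succ fun k => by
      rw [Prod.Lex.toLex_lt_toLex]
      exact (hlt k).imp id fun h => ⟨h.1, OrderDual.toDual_lt_toDual.2 h.2⟩
  have hinj : Function.Injective u := fun i j h => hstrict.injective (by simp only [h])
  have hinc : ∀ d k, δ (u k) ≤ d → ∃ k', ν (u k) < ν (u k') := by
    intro d
    induction d with
    | zero =>
      intro k hk
      rcases hlt k with h | h
      · exact ⟨_, h⟩
      · omega
    | succ d ih =>
      intro k hk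
      rcases hlt k with h | h
      · exact ⟨_, h⟩
      · obtain ⟨k', hk'⟩ := ih (k + 1) (by omega)
        exact ⟨k', h.1 ▸ hk'⟩
  have hunb : ∀ n, ∃ k, n ≤ ν (u k) := by
    intro n
    induction n with
    | zero => exact ⟨0, Nat.zero_le _⟩
    | succ n ih =>
      obtain ⟨k, hk⟩ := ih
      obtain ⟨k', hk'⟩ := hinc _ k le_rfl
      exact ⟨k', by omega⟩
  refine ⟨⟨u, hinj, fun k => hus k ▸ hfadj _ (hu0 k)⟩, fun n => ?_⟩
  obtain ⟨k, hk⟩ := hunb n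
  exact eventually_atTop.2 ⟨k, fun m hm => hS (hk.trans (hmono hm)) (hν1 _ (hu0 m))⟩

/-! ### Splitting a graph along its infinitely edge-connected classes -/

/-- The vertices that no finite set of edges separates from `r`. -/
def infClass (G : SimpleGraph V) (r : V) : Set V := {x | ∀ U, FinCut G U → r ∈ U → x ∈ U}

theorem self_mem_infClass (r : V) : r ∈ infClass G r := fun _ _ h => h

theorem mem_iff_of_mem_infClass {r x : V} (h : x ∈ infClass G r) {D : Set V} (hD : FinCut G D) :
    x ∈ D ↔ r ∈ D := by
  refine ⟨fun hx => ?_, h D hD⟩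
  by_contra hr
  exact h _ hD.compl hr hx

/-- A splitting of the connected sets of finite boundary whose cores are classes of infinitely
edge-connected vertices. -/
structure ClassSplitting (G : SimpleGraph V) extends Splitting V where
  rep : Set V → V
  good_iff : ∀ N, Good N ↔ N.Nonempty ∧ IsConn G N ∧ FinCut G N
  core_eq : ∀ N, core N = infClass G (rep N)
  rep_mem : ∀ {N}, Good N → rep N ∈ N
  rep_min : ∀ {N}, Good N → ∀ z ∈ N, rootDist G (rep N) ≤ rootDist G z
  finite_meet : ∀ {N D}, Good N → FinCut G D → rep N ∉ D →
    {P | ∃ x ∈ N, x ∉ core N ∧ P = part N x ∧ (P ∩ D).Nonempty}.Finite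

theorem nonempty_classSplitting (hG : G.Connected) : Nonempty (ClassSplitting G) := by
  have h1 : ∀ N : Set V, (N.Nonempty ∧ IsConn G N ∧ FinCut G N) →
      ∃ r ∈ N, (∀ z ∈ N, rootDist G r ≤ rootDist G z) ∧ ∃ part : V → Set V,
        ∀ x ∈ N \ infClass G r, x ∈ part x ∧ part x ⊆ N \ infClass G r ∧ IsConn G (part x) ∧
          FinCut G (part x) ∧ (∃ a ∈ part x, ∃ b ∉ N \ infClass G r, G.Adj a b) ∧
          ∀ y ∈ part x, part y = part x := by
    rintro N ⟨hne, -, hN⟩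
    obtain ⟨r, hr, hmin⟩ := WellFounded.has_min (measure (rootDist G)).wf N hne
    refine ⟨r, hr, fun z hz => not_lt.1 (hmin z hz), exists_partition hG ?_ ?_⟩
    · exact (Set.ne_univ_iff_exists_notMem _).2 ⟨r, fun h => h.2 (self_mem_infClass r)⟩
    · rintro x ⟨hxN, hx⟩
      simp only [infClass, Set.mem_ofPred_eq, not_forall] at hx
      obtain ⟨U, hU, hrU, hxU⟩ := hx
      exact ⟨Uᶜ ∩ N, fun y hy => ⟨hy.2, fun h => hy.1 (h U hU hrU)⟩, ⟨hxU, hxN⟩,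
        hU.compl.inter hN⟩
  have : Nonempty V := hG.nonempty
  choose! r hrN hmin part hx hsub hconn hfin hadj heq using h1
  have heq' : ∀ {N x y}, (N.Nonempty ∧ IsConn G N ∧ FinCut G N) → x ∈ N → x ∉ infClass G (r N) →
      y ∈ part N x → part N y = part N x := fun hN hxN hxc hy => heq _ hN _ ⟨hxN, hxc⟩ _ hy
  refine ⟨
    { Good := fun N => N.Nonempty ∧ IsConn G N ∧ FinCut G N
      core := fun N => infClass G (r N)
      part := part
      mem_part := fun hN hxN hxc => hx _ hN _ ⟨hxN, hxc⟩
      part_subset := fun hN hxN hxc => hsub _ hN _ ⟨hxN, hxc⟩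
      good_part := fun hN hxN hxc => ⟨⟨_, hx _ hN _ ⟨hxN, hxc⟩⟩, hconn _ hN _ ⟨hxN, hxc⟩,
        hfin _ hN _ ⟨hxN, hxc⟩⟩
      part_eq := heq'
      rep := r
      good_iff := fun _ => Iff.rfl
      core_eq := fun _ => rfl
      rep_mem := fun hN => hrN _ hN
      rep_min := fun hN => hmin _ hN
      finite_meet := ?_ }⟩
  intro N D hN hD hr
  -- Each part meeting `D` contains an end of a boundary edge of `D` or of `N`. If it is not split
  -- by `D`, it lies in `D`, and its edge out of `N` minus the core leads either into the core,
  -- which `D` misses, or out of `N`.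
  refine ((hD.finite_cutVerts.union hN.2.2.finite_cutVerts).image (part N)).subset ?_
  rintro _ ⟨x, hxN, hxc, rfl, y, hyP, hyD⟩
  have hxY : x ∈ N \ infClass G (r N) := ⟨hxN, hxc⟩
  have key : ∃ f ∈ part N x, f ∈ cutVerts G D ∪ cutVerts G N := by
    by_cases hsubD : part N x ⊆ D
    · obtain ⟨a, ha, b, hb, hab⟩ := hadj N hN x hxY
      refine ⟨a, ha, ?_⟩
      by_cases hbN : b ∈ N
      · have hbD : b ∉ D := fun h => hb ⟨hbN, fun hbc => hr ((mem_iff_of_mem_infClass hbc hD).1 h)⟩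
        exact Or.inl (mem_cutVerts_left hab (hsubD ha) hbD)
      · exact Or.inr (mem_cutVerts_left hab (hsub N hN x hxY ha).1 hbN)
    · obtain ⟨w, hw, hwD⟩ := Set.not_subset.1 hsubD
      obtain ⟨f, hf, hf'⟩ := (hconn N hN x hxY).exists_mem_cutVerts hyP hw hyD hwD
      exact ⟨f, hf, Or.inl hf'⟩
  obtain ⟨f, hf, hf'⟩ := key
  exact ⟨f, hf', heq' hN hxN hxc hf⟩

/-! ### The tree of nodes. -/

namespace ClassSplitting

variable (σ : ClassSplitting G)

/-- The vertices of the tree of a splitting: the sets that arise from the whole graph. -/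
def Node : Type u := {N : Set V // σ.IsNode Set.univ N}

variable {σ}

/-- `M` is one of the parts of `N`. -/
def IsChild (M N : σ.Node) : Prop := ∃ x ∈ N.1, x ∉ σ.core N.1 ∧ M.1 = σ.part N.1 x

theorem good_univ (σ : ClassSplitting G) (hG : G.Connected) : σ.Good Set.univ := by
  obtain ⟨x⟩ := hG.nonempty
  refine (σ.good_iff _).2 ⟨⟨x, trivial⟩, fun x _ y _ => ?_, finCut_univ⟩
  exact (hG.preconnected x y).mono fun a b h => ⟨h, trivial, trivial⟩

theorem Node.good (hG : G.Connected) (N : σ.Node) : σ.Good N.1 :=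
  N.2.good (σ.good_univ hG)

theorem Node.conn (hG : G.Connected) (N : σ.Node) : IsConn G N.1 :=
  ((σ.good_iff _).1 (N.good hG)).2.1

theorem Node.finCut (hG : G.Connected) (N : σ.Node) : FinCut G N.1 :=
  ((σ.good_iff _).1 (N.good hG)).2.2

theorem rep_mem_core (N : Set V) : σ.rep N ∈ σ.core N := by
  rw [σ.core_eq]
  exact self_mem_infClass _

theorem IsChild.subset_sdiff (hG : G.Connected) {M N : σ.Node} (h : IsChild M N) :
    M.1 ⊆ N.1 \ σ.core N.1 := by
  obtain ⟨x, hx, hxc, h⟩ := h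
  exact h ▸ σ.part_subset (N.good hG) hx hxc

theorem IsChild.subset (hG : G.Connected) {M N : σ.Node} (h : IsChild M N) : M.1 ⊆ N.1 :=
  (h.subset_sdiff hG).trans Set.sdiff_subset

theorem IsChild.not_subset (hG : G.Connected) {M N : σ.Node} (h : IsChild M N) : ¬ N.1 ⊆ M.1 :=
  fun h' => (h.subset_sdiff hG (h' (σ.rep_mem (N.good hG)))).2 (rep_mem_core _)

theorem exists_mem_core (σ : ClassSplitting G) (hG : G.Connected) (x : V) :
    ∃ n, x ∈ σ.core (σ.chain Set.univ x n) :=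
  Splitting.exists_mem_core (σ.good_univ hG) G (fun N hN => ((σ.good_iff N).1 hN).2.2)
    (fun _ _ x _ y _ => hG.preconnected x y)
    (fun N hN _ => ⟨σ.rep N, σ.rep_mem hN, rep_mem_core N, σ.rep_min hN⟩) (Set.mem_univ x)

/-- A node that meets a child `M` of `N` lies in `M` or contains `N`. -/
theorem IsChild.subset_or_subset (hG : G.Connected) {M N K : σ.Node} (h : IsChild M N)
    (hK : (K.1 ∩ M.1).Nonempty) : K.1 ⊆ M.1 ∨ N.1 ⊆ K.1 := by
  have huniv := σ.good_univ hG
  obtain ⟨x, hxK, hxM⟩ := hK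
  have hx := h.subset_sdiff hG hxM
  obtain ⟨k, hk, hkeq⟩ := K.2.eq_chain huniv hxK
  obtain ⟨n, hn, hneq⟩ := N.2.eq_chain huniv hx.1
  have hn' : σ.Alive Set.univ x (n + 1) := fun m hm => by
    rcases Nat.lt_succ_iff_lt_or_eq.1 hm with h | rfl
    · exact hn m h
    · exact hneq ▸ hx.2
  have hM : M.1 = σ.chain Set.univ x (n + 1) := by
    obtain ⟨y, hy, hyc, hMy⟩ := h
    rw [Splitting.chain, ← hneq, hMy]
    exact (σ.part_eq (N.good hG) hy hyc (hMy ▸ hxM)).symm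
  rcases Nat.lt_or_ge n k with hlt | hle
  · left
    rw [hkeq, hM]
    exact Splitting.chain_subset_of_le huniv (Set.mem_univ x) hlt hk
  · right
    rw [hkeq, hneq]
    exact Splitting.chain_subset_of_le huniv (Set.mem_univ x) hle hn

theorem Node.nonempty (hG : G.Connected) (N : σ.Node) : N.1.Nonempty := ⟨_, σ.rep_mem (N.good hG)⟩

theorem IsChild.parent_unique (hG : G.Connected) {M N N' : σ.Node} (h : IsChild M N)
    (h' : IsChild M N') : N = N' := by
  have key : ∀ {N N' : σ.Node}, IsChild M N → IsChild M N' → N.1 ⊆ N'.1 := by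
    intro N N' h h'
    obtain ⟨x, hx⟩ := M.nonempty hG
    exact (h.subset_or_subset hG ⟨x, h'.subset hG hx, hx⟩).resolve_left (h'.not_subset hG)
  exact Subtype.ext ((key h h').antisymm (key h' h))

/-- The nodes containing `x` form its chain, which stops once `x` is in a core. -/
theorem finite_nodes (hG : G.Connected) (x : V) : {N : σ.Node | x ∈ N.1}.Finite := by
  obtain ⟨n, hn⟩ := σ.exists_mem_core hG x
  have : ((σ.chain Set.univ x) '' Set.Iic n).Finite := (Set.finite_Iic n).image _
  refine (this.preimage Subtype.val_injective.injOn).subset fun N hN => ?_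
  obtain ⟨m, hm, h⟩ := N.2.eq_chain (σ.good_univ hG) hN
  refine ⟨m, ?_, h.symm⟩
  by_contra hcon
  exact hm n (not_le.1 hcon) hn

/-- The node whose core contains `x`. -/
theorem exists_proj (σ : ClassSplitting G) (hG : G.Connected) : ∃ π : V → σ.Node, ∀ x,
    x ∈ (π x).1 ∧ x ∈ infClass G (σ.rep (π x).1) ∧ ∀ M : σ.Node, (π x).1 ⊆ M.1 ↔ x ∈ M.1 := by
  have huniv := σ.good_univ hG
  have : ∀ x, ∃ N : σ.Node, x ∈ N.1 ∧ x ∈ infClass G (σ.rep N.1) ∧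
      ∀ M : σ.Node, N.1 ⊆ M.1 ↔ x ∈ M.1 := by
    intro x
    obtain ⟨n, hn, hc, hnode⟩ := Splitting.exists_last_node huniv (Set.mem_univ x)
      (σ.exists_mem_core hG x)
    have hmem := (Splitting.mem_good_chain huniv (Set.mem_univ x) hn).1
    refine ⟨⟨_, hnode⟩, hmem, σ.core_eq _ ▸ hc, fun M => ⟨fun h => h hmem, fun hx => ?_⟩⟩
    obtain ⟨m, hm, h⟩ := M.2.eq_chain huniv hx
    rw [h]
    refine Splitting.chain_subset_of_le huniv (Set.mem_univ x) ?_ hn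
    by_contra hcon
    exact hm n (not_le.1 hcon) hc
  choose π hπ using this
  exact ⟨π, hπ⟩

/-- The tree of a splitting. -/
def tree (σ : ClassSplitting G) (hG : G.Connected) : SimpleGraph σ.Node where
  Adj M N := IsChild M N ∨ IsChild N M
  symm := ⟨fun _ _ h => h.symm⟩
  loopless := ⟨fun _ h => (h.elim id id).not_subset hG subset_rfl⟩

variable (hG : G.Connected)

/-- Only an upward step can leave the nodes inside `M`, and by `IsChild.subset_or_subset` only from
`M` itself. -/
theorem eq_of_tree_boundary {M N K L : σ.Node} (h : IsChild M N) (hKL : (σ.tree hG).Adj K L)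
    (hK : K.1 ⊆ M.1) (hL : ¬ L.1 ⊆ M.1) : K = M ∧ L = N := by
  rcases hKL with hKL | hKL
  · obtain ⟨x, hx⟩ := K.nonempty hG
    have hMK := (hKL.subset_or_subset hG ⟨x, hK hx, hx⟩).resolve_right hL
    have hKM : K = M := Subtype.ext (hK.antisymm hMK)
    exact ⟨hKM, (hKM ▸ hKL).parent_unique hG h⟩
  · exact (hL ((hKL.subset hG).trans hK)).elim

theorem subset_iff_of_reachable {M N K L : σ.Node} (h : IsChild M N)
    (hKL : ((σ.tree hG).deleteEdges {s(M, N)}).Reachable K L) : K.1 ⊆ M.1 ↔ L.1 ⊆ M.1 := by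
  have key : ∀ {K L : σ.Node}, ((σ.tree hG).deleteEdges {s(M, N)}).Reachable K L →
      K.1 ⊆ M.1 → L.1 ⊆ M.1 := by
    intro K L hKL hK
    by_contra hL
    obtain ⟨a, b, ha, hb, hab⟩ := hKL.exists_adj_boundary (D := {K | K.1 ⊆ M.1}) hK hL
    rw [deleteEdges_adj] at hab
    obtain ⟨rfl, rfl⟩ := eq_of_tree_boundary hG h hab.1 ha hb
    exact hab.2 rfl
  exact ⟨key hKL, key hKL.symm⟩

/-- Splitting steps connect every node to the root, and `subset_iff_of_reachable` makes every edge a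
bridge. -/
theorem isTree_tree : (σ.tree hG).IsTree := by
  have hroot : ∀ N (hN : σ.IsNode Set.univ N),
      (σ.tree hG).Reachable ⟨Set.univ, Splitting.IsNode.root⟩ ⟨N, hN⟩ := by
    intro N hN
    induction hN with
    | root => exact Reachable.refl _
    | part hN hx hxc ih => exact ih.trans (Adj.reachable (Or.inr ⟨_, hx, hxc, rfl⟩))
  have : Nonempty σ.Node := ⟨⟨Set.univ, Splitting.IsNode.root⟩⟩
  refine ⟨Connected.mk fun M N => (hroot M.1 M.2).symm.trans (hroot N.1 N.2), ?_⟩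
  rw [isAcyclic_iff_forall_adj_isBridge]
  intro M N hMN
  rw [isBridge_iff]
  rcases hMN with h | h
  · exact fun hr => h.not_subset hG ((subset_iff_of_reachable hG h hr).1 subset_rfl)
  · rw [Sym2.eq_swap]
    exact fun hr => h.not_subset hG ((subset_iff_of_reachable hG h hr).2 subset_rfl)

theorem side_tree {M N : σ.Node} (h : IsChild M N) : side (σ.tree hG) N M = {K | K.1 ⊆ M.1} := by
  ext K
  constructor
  · intro hK
    rw [side, Set.mem_ofPred_eq, Sym2.eq_swap] at hK
    exact (subset_iff_of_reachable hG h hK).1 subset_rfl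
  · intro hK
    by_contra hcon
    have hcon' : K ∈ side (σ.tree hG) M N := (isTree_tree hG).compl_side (Or.inr h) ▸ hcon
    exact h.not_subset hG ((subset_iff_of_reachable hG h hcon').2 hK)

end ClassSplitting

end SimpleGraph

/-! ### Finite cuts and ends of the graph versus those of its tree. -/

namespace SimpleGraph

open Filter Topology

variable {V W : Type u} {G : SimpleGraph V} {T : SimpleGraph W}

/-- This charges an edge of `G` across the preimage of `U` to a boundary edge of `U` that separates
the images of its ends. -/
theorem IsTree.exists_side_of_boundary (hT : T.IsTree) {U : Set W} {u v : W} (hu : u ∈ U)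
    (hv : v ∉ U) : ∃ a b, T.Adj a b ∧ a ∈ U ∧ b ∉ U ∧ u ∉ side T a b ∧ v ∈ side T a b := by
  obtain ⟨p, hp⟩ := (hT.connected.preconnected u v).exists_isPath
  induction p with
  | nil => exact (hv hu).elim
  | @cons u c v hadj q ih =>
    rw [Walk.cons_isPath_iff] at hp
    by_cases hc : c ∈ U
    · obtain ⟨a, b, hab, ha, hb, hca, hva⟩ := ih hc hv hp.1
      refine ⟨a, b, hab, ha, hb, fun hua => hb ?_, hva⟩
      exact (hT.eq_of_side_boundary hab hua hca hadj).1 ▸ hu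
    · exact ⟨u, c, hadj, hu, hc, hT.left_notMem_side hadj,
        reachable_deleteEdges_iff_exists_walk.2
          ⟨q, fun hmem => hp.2 (q.fst_mem_support_of_mem_edges hmem)⟩⟩

/-- It suffices to check finiteness of the boundaries of preimages on the sides of the edges. -/
theorem IsTree.finCut_preimage (hT : T.IsTree) {π : V → W}
    (h : ∀ a b, T.Adj a b → FinCut G (π ⁻¹' side T a b)) {U : Set W} (hU : FinCut T U) :
    FinCut G (π ⁻¹' U) := by
  have hfin : (⋃ a ∈ cutVerts T U, ⋃ b ∈ cutVerts T U,
      {e | T.Adj a b ∧ e ∈ cutEdges G (π ⁻¹' side T a b)}).Finite := by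
    refine hU.finite_cutVerts.biUnion fun a _ => hU.finite_cutVerts.biUnion fun b _ => ?_
    by_cases hab : T.Adj a b
    · exact Set.Finite.subset (h a b hab) fun e he => he.2
    · exact Set.finite_empty.subset fun e he => hab he.1
  refine FinCut.of_subset hfin fun x y hx hy hxy => ?_
  obtain ⟨a, b, hab, ha, hb, hxa, hya⟩ := hT.exists_side_of_boundary (U := U) hx hy
  exact Set.mem_biUnion (mem_cutVerts_left hab ha hb) (Set.mem_biUnion
    ⟨a, mem_cutEdges.2 ⟨hab.symm, Or.inr ⟨hb, ha⟩⟩⟩ ⟨hab, mem_cutEdges.2 ⟨hxy, Or.inr ⟨hxa, hya⟩⟩⟩)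

namespace ClassSplitting

variable {σ : ClassSplitting G} (hG : G.Connected)

/-- The preimage of the side below a tree edge is the child itself, a set of finite boundary. -/
theorem finCut_preimage_tree {π : V → σ.Node} (hπ : ∀ x, ∀ M : σ.Node, (π x).1 ⊆ M.1 ↔ x ∈ M.1)
    {U : Set σ.Node} (hU : FinCut (σ.tree hG) U) : FinCut G (π ⁻¹' U) := by
  have hchild : ∀ M N : σ.Node, IsChild M N → π ⁻¹' side (σ.tree hG) N M = M.1 := by
    intro M N h
    rw [side_tree hG h]
    exact Set.ext fun x => hπ x M
  refine (isTree_tree hG).finCut_preimage (fun a b hab => ?_) hU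
  rcases hab with h | h
  · rw [← (isTree_tree hG).compl_side (a := b) (b := a) (Or.inr h), Set.preimage_compl,
      hchild _ _ h]
    exact (a.finCut hG).compl
  · rw [hchild _ _ h]
    exact b.finCut hG

/-- A boundary edge joins some `N` to a child. As `N` is connected and contains both
representatives, it contains an end of a boundary edge of `D`, which leaves finitely many `N` by
`finite_nodes`; `finite_meet`, for `D` or `Dᶜ`, bounds the children. -/
theorem finCut_tree_of_finCut {D : Set V} (hD : FinCut G D) :
    FinCut (σ.tree hG) {N | σ.rep N.1 ∈ D} := by
  set P : Set σ.Node := ⋃ f ∈ cutVerts G D, {N | f ∈ N.1} with hP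
  have hPf : P.Finite := hD.finite_cutVerts.biUnion fun f _ => finite_nodes hG f
  set C : σ.Node → Set σ.Node := fun N =>
    {M | IsChild M N ∧ ¬ (σ.rep M.1 ∈ D ↔ σ.rep N.1 ∈ D)} with hC
  have hCf : ∀ N, (C N).Finite := by
    intro N
    have key : ∀ E : Set V, FinCut G E → σ.rep N.1 ∉ E →
        {M : σ.Node | IsChild M N ∧ σ.rep M.1 ∈ E}.Finite := by
      intro E hE hN
      refine ((σ.finite_meet (N.good hG) hE hN).preimage Subtype.val_injective.injOn).subset ?_
      rintro M ⟨⟨x, hx, hxc, h⟩, hM⟩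
      exact ⟨x, hx, hxc, h, σ.rep M.1, σ.rep_mem (Node.good hG M), hM⟩
    by_cases hN : σ.rep N.1 ∈ D
    · refine (key Dᶜ hD.compl (fun h => h hN)).subset fun M hM => ⟨hM.1, fun h => hM.2 ?_⟩
      exact iff_of_true h hN
    · refine (key D hD hN).subset fun M hM => ⟨hM.1, ?_⟩
      by_contra h
      exact hM.2 (iff_of_false h hN)
  have hmem : ∀ M N : σ.Node, IsChild M N → ¬ (σ.rep M.1 ∈ D ↔ σ.rep N.1 ∈ D) →
      s(N, M) ∈ ⋃ N ∈ P, (fun M => s(N, M)) '' C N := by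
    intro M N h hne
    refine Set.mem_biUnion (x := N) ?_ ⟨M, ⟨h, hne⟩, rfl⟩
    have hM := h.subset hG (σ.rep_mem (M.good hG))
    have hN := σ.rep_mem (N.good hG)
    obtain ⟨f, hf, hf'⟩ : ∃ f ∈ N.1, f ∈ cutVerts G D := by
      by_cases hND : σ.rep N.1 ∈ D
      · exact (N.conn hG).exists_mem_cutVerts hN hM hND fun h' => hne (iff_of_true h' hND)
      · refine (N.conn hG).exists_mem_cutVerts hM hN ?_ hND
        by_contra h'
        exact hne (iff_of_false h' hND)
    exact Set.mem_biUnion hf' hf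
  refine FinCut.of_subset (hPf.biUnion fun N _ => (hCf N).image fun M => s(N, M))
    fun A B hA hB hAB => ?_
  have hne : ¬ (σ.rep A.1 ∈ D ↔ σ.rep B.1 ∈ D) := fun h => hB (h.1 hA)
  rcases hAB with h | h
  · rw [Sym2.eq_swap]
    exact hmem A B h hne
  · exact hmem B A h fun h' => hne h'.symm

/-- A ray of the tree eventually descends. -/
theorem exists_forall_isChild (R : EdgeRay (σ.tree hG)) :
    ∃ N, ∀ n ≥ N, IsChild (R.vert (n + 1)) (R.vert n) := by
  have hstep : ∀ n, IsChild (R.vert (n + 1)) (R.vert n) →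
      IsChild (R.vert (n + 2)) (R.vert (n + 1)) := fun n h =>
    (R.adj (n + 1)).resolve_left fun h' => R.ne_add_two n (h'.parent_unique hG h)
  -- A ray ascending forever would give infinitely many nodes around one vertex.
  obtain ⟨N, hN⟩ : ∃ N, IsChild (R.vert (N + 1)) (R.vert N) := by
    by_contra! hcon
    have hup : ∀ n, IsChild (R.vert n) (R.vert (n + 1)) := fun n =>
      (R.adj n).resolve_right (hcon n)
    have hmono : Monotone fun n => (R.vert n).1 :=
      monotone_nat_of_le_succ fun n => (hup n).subset hG
    exact Set.infinite_of_injective_forall_mem R.injective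
      (fun n => hmono (Nat.zero_le n) (σ.rep_mem ((R.vert 0).good hG))) (finite_nodes hG _)
  refine ⟨N, fun n hn => ?_⟩
  induction n, hn using Nat.le_induction with
  | base => exact hN
  | succ n _ ih => exact hstep n ih

/-- Every end of the tree comes from an edge-end of the graph. -/
theorem exists_edgeEnd_of_ray {π : V → σ.Node} (hπ : ∀ x, ∀ M : σ.Node, (π x).1 ⊆ M.1 ↔ x ∈ M.1)
    (R : EdgeRay (σ.tree hG)) : ∃ ω : EdgeEnd G, ∀ U, FinCut (σ.tree hG) U →
      R.toEnd.LivesIn U → ω.LivesIn (π ⁻¹' U) := by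
  have hT := isTree_tree (σ := σ) hG
  obtain ⟨N, hN⟩ := exists_forall_isChild hG R
  have hside : ∀ n ≥ N, ∀ x,
      x ∈ (R.vert (n + 1)).1 ↔ π x ∈ side (σ.tree hG) (R.vert n) (R.vert (n + 1)) := by
    intro n hn x
    rw [side_tree hG (hN n hn)]
    exact (hπ x _).symm
  have hanti : Antitone fun n => (R.vert (N + n + 1)).1 :=
    antitone_nat_of_succ_le fun n => (hN (N + n + 1) (by omega)).subset hG
  have hempty : ⋂ n, (R.vert (N + n + 1)).1 = ∅ := by
    refine Set.eq_empty_of_forall_notMem fun x hx => ?_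
    rw [Set.mem_iInter] at hx
    refine Set.notMem_empty (π x) (hT.iInter_side R.adj R.ne_add_two ▸ Set.mem_iInter.2 fun n => ?_)
    exact hT.antitone_side R.adj R.ne_add_two (Nat.le_add_left n N)
      ((hside (N + n) (by omega) x).1 (hx n))
  obtain ⟨Q, hQ⟩ := exists_ray_of_antitone hanti (fun n => Node.conn hG _)
    (fun n => Node.nonempty hG _) hempty
  refine ⟨Q.toEnd, fun U hU h => ?_⟩
  rw [R.livesIn_iff hU] at h
  rw [Q.livesIn_iff (finCut_preimage_tree hG hπ hU)]
  obtain ⟨M, hM⟩ := R.exists_side_subset hT hU h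
  filter_upwards [hQ M] with m hm
  exact hM (N + M) (by omega) ((hside (N + M) (by omega) _).1 hm)

end ClassSplitting

/-- The edge-end space of a connected graph is a subspace of `‖T‖` that contains all ends, for
some tree `T`. -/
theorem Connected.exists_homeomorph_vertexEnd (hG : G.Connected) :
    ∃ (W : Type u) (T : SimpleGraph W) (X : Set (VertexEnd T)), T.IsTree ∧
      (∀ ω : EdgeEnd T, VertexEnd.edgeEnd ω ∈ X) ∧ Nonempty (EdgeEnd G ≃ₜ X) := by
  obtain ⟨σ⟩ := nonempty_classSplitting hG
  obtain ⟨π, hπ⟩ := σ.exists_proj hG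
  have hπ' := fun x => (hπ x).2.2
  have hT := ClassSplitting.isTree_tree (σ := σ) hG
  obtain ⟨Φ, hΦ, hrel⟩ := exists_isEmbedding hT π
    (fun U hU => ClassSplitting.finCut_preimage_tree hG hπ' hU)
    -- No finite boundary separates `x` from the representative of `π x`, so `D` is the preimage of
    -- the nodes whose representative lies in `D`.
    (fun D hD => ⟨_, ClassSplitting.finCut_tree_of_finCut (σ := σ) hG hD,
      Set.ext fun x => mem_iff_of_mem_infClass (hπ x).2.1 hD⟩)
  refine ⟨_, σ.tree hG, Set.range Φ, hT, fun ω => ?_, ⟨hΦ.toHomeomorph⟩⟩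
  obtain ⟨R, rfl⟩ := ω.exists_ray
  obtain ⟨ω, hω⟩ := ClassSplitting.exists_edgeEnd_of_ray hG hπ' R
  exact ⟨ω, (hT.eq_of_forall_mem_hull fun U hU hp => (hrel _ U hU).2
    (hω U hU (VertexEnd.edgeEnd_mem_hull.1 hp))).symm⟩

end SimpleGraph

theorem theorem1p2 (Z : Type v) [TopologicalSpace Z] :
    (∃ (V : Type u) (G : SimpleGraph V), G.Connected ∧ Nonempty (Z ≃ₜ SimpleGraph.EdgeEnd G)) ↔
      (∃ (W : Type u) (T : SimpleGraph W) (X : Set (SimpleGraph.VertexEnd T)),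
        T.IsTree ∧
        (∀ ω : SimpleGraph.EdgeEnd T, SimpleGraph.VertexEnd.edgeEnd ω ∈ X) ∧
        Nonempty (Z ≃ₜ X)) := by
  constructor
  · rintro ⟨V, G, hG, ⟨e⟩⟩
    obtain ⟨W, T, X, hT, hX, ⟨f⟩⟩ := hG.exists_homeomorph_vertexEnd
    exact ⟨W, T, X, hT, hX, ⟨e.trans f⟩⟩
  · rintro ⟨W, T, X, hT, hX, ⟨e⟩⟩
    obtain ⟨V, G, hG, ⟨f⟩⟩ := hT.exists_homeomorph_edgeEnd hX
    exact ⟨V, G, hG, ⟨e.trans f.symm⟩⟩
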